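/- **Theorem 1 (Consistency of the frequency domain estimator).** Let $d\ge1$, let $\Theta\subset\mathbb{R}^d$ be compact and let $\theta$, the true parameter, lie in the interior of $\Theta$. For every $\gamma\in\Theta$ let $\{X_t\}_{t\in\mathbb{N}}$ be, under the law $P_\gamma$, a real-valued, zero-mean, stationary Gaussian process with autocovariances $c_X(\tau;\gamma)=\operatorname{Cov}_\gamma(X_t,X_{t+\tau})$, $\tau\ge 0$, extended by $c_X(-\tau;\gamma)=c_X(\tau;\gamma)$, and assume that 1. $\sum_{\tau\ge 0}|c_X(\tau;\gamma)|<\infty$ for every $\gamma\in\Theta$, and $\gamma\mapsto c_X(\tau;\gamma)$ is continuous on $\Theta$ for every $\tau$; 2. the spectral density $S_X(\omega;\gamma)=\frac{1}{2\pi}\sum_{\tau\in\mathbb{Z}}c_X(\tau;\gamma)e^{-i\omega\tau}$ is continuous in $(\omega,\gamma)$ and positive on $[-\pi,\pi]\times\Theta$, and for every $\gamma\in\Theta$ it is continuously differentiable in $\omega\in[-\pi,\pi]$. Let $\{g_t\}_{t\in\mathbb{N}}$ be a bounded deterministic real sequence, let $Y_t=g_tX_t$, and put $c_g^{(N)}(\tau)=\frac1N\sum_{t=0}^{N-1-\tau}g_tg_{t+\tau}$.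 Assume that $Y_t$ has a significant correlation contribution: there is a finite set $\Gamma\subset\mathbb{N}$ of lags such that $\gamma\mapsto(c_X(\tau;\gamma))_{\tau\in\Gamma}$ is injective on $\Theta$ and $\liminf_{N\to\infty}|c_g^{(N)}(\tau)|>0$ for every $\tau\in\Gamma$. Let $\hat S_Y^{(N)}(\omega)=\frac1N\bigl|\sum_{t=0}^{N-1}Y_te^{-i\omega t}\bigr|^2$ be the periodogram, $\overline S_Y^{(N)}(\omega;\gamma)=\mathbb{E}_\gamma\{\hat S_Y^{(N)}(\omega)\}$ the expected periodogram, $\Omega_N=\frac{2\pi}{N}\{-\lceil N/2\rceil+1,\dots,\lfloor N/2\rfloor\}$ the set of Fourier frequencies, and $$\ell_M(\gamma)=\frac1N\sum_{\omega\in\Omega_N}\left\{\log\overline S_Y^{(N)}(\omega;\gamma)+\frac{\hat S_Y^{(N)}(\omega)}{\overline S_Y^{(N)}(\omega;\gamma)}\right\},\qquad \gamma\in\Theta.$$ (If $g_0=\dots=g_{N-1}=0$, then $\overline S_Y^{(N)}$ vanishes identically and $\ell_M$ is taken to be constant; under the assumptions this happens for finitely many $N$ only.) Then $\ell_M$ has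 a minimiser over $\Theta$ for every $N$ and every realization, and if $\hat\theta^{(N)}$ is any such minimiser, chosen arbitrarily if there are several, then $\hat\theta^{(N)}\to\theta$ in probability under $P_\theta$ as $N\to\infty$. -/

import Mathlib

open MeasureTheory ProbabilityTheory Filter Set
open scoped Topology Real

noncomputable section

namespace ModulatedSeries

/-- A real-valued, zero-mean, second-order stationary Gaussian process indexed by `ℕ`
(Gaussianity forces `μ` to be a probability measure and all moments to be finite). -/
structure IsStationaryGaussian {Ω : Type*} [MeasurableSpace Ω]
    (X : ℕ → Ω → ℝ) (μ : Measure Ω) : Prop where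
  gaussian : IsGaussianProcess X μ
  mean_zero : ∀ t, ∫ w, X t w ∂μ = 0
  stationary : ∀ t τ, cov[X t, X (t + τ); μ] = cov[X 0, X τ; μ]

/-- The autocovariance `c_X(τ)` of a stationary process, at lag `τ ≥ 0`. -/
def autocov {Ω : Type*} [MeasurableSpace Ω] (X : ℕ → Ω → ℝ) (μ : Measure Ω) (τ : ℕ) : ℝ :=
  cov[X 0, X τ; μ]

/-- The spectral density `S_X(ω) = (1 / 2π) ∑_{τ ∈ ℤ} c_X(τ) e^{-iωτ}`, with
`c_X(-τ) = c_X(τ)`. By this symmetry the sum is real. -/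
def spectralDensity {Ω : Type*} [MeasurableSpace Ω] (X : ℕ → Ω → ℝ) (μ : Measure Ω)
    (ω : ℝ) : ℝ :=
  (1 / (2 * (π : ℂ)) * ∑' τ : ℤ, (autocov X μ τ.natAbs : ℂ) *
    Complex.exp (-Complex.I * (ω : ℂ) * (τ : ℂ))).re

/-- The modulated process `Y_t = g_t X_t`. -/
def modulate {Ω : Type*} (g : ℕ → ℝ) (X : ℕ → Ω → ℝ) : ℕ → Ω → ℝ :=
  fun t w => g t * X t w

/-- The sample autocovariance `c_g^{(N)}(τ) = (1 / N) ∑_{t=0}^{N-1-τ} g_t g_{t+τ}`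
(an empty sum if `N ≤ τ`). -/
def sampleAutocov (g : ℕ → ℝ) (N τ : ℕ) : ℝ :=
  (1 / (N : ℝ)) * ∑ t ∈ Finset.range (N - τ), g t * g (t + τ)

/-- The modulated process `g_t X_t`, where `X` has law `P θ` for `θ ∈ Θ`, has a significant
correlation contribution. -/
def SignificantCorrelationContribution {Ω E : Type*} [MeasurableSpace Ω]
    (Θ : Set E) (P : E → Measure Ω) (X : ℕ → Ω → ℝ) (g : ℕ → ℝ) : Prop :=
  ∃ Γ : Finset ℕ,
    InjOn (fun θ => fun τ : Γ => autocov X (P θ) (τ : ℕ)) Θ ∧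
    ∀ τ ∈ Γ, 0 < liminf (fun N : ℕ => |sampleAutocov g N τ|) atTop

/-- The Fourier frequencies `(2π / N) k`, `k = -⌈N/2⌉ + 1, …, ⌊N/2⌋`. -/
def fourierFrequencies (N : ℕ) : Finset ℝ :=
  (Finset.Icc (-(((N + 1) / 2 : ℕ) : ℤ) + 1) ((N / 2 : ℕ) : ℤ)).image
    (fun k : ℤ => 2 * π / (N : ℝ) * (k : ℝ))

/-- The periodogram `(1 / N) |∑_{t=0}^{N-1} y_t e^{-iωt}|²` of a sample `y_0, …, y_{N-1}`. -/
def periodogram (y : ℕ → ℝ) (N : ℕ) (ω : ℝ) : ℝ :=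
  (1 / (N : ℝ)) *
    ‖∑ t ∈ Finset.range N, (y t : ℂ) * Complex.exp (-Complex.I * (ω : ℂ) * (t : ℂ))‖ ^ 2

/-- The expected periodogram of the process `Y` under `μ`. -/
def expectedPeriodogram {Ω : Type*} [MeasurableSpace Ω] (Y : ℕ → Ω → ℝ) (μ : Measure Ω)
    (N : ℕ) (ω : ℝ) : ℝ :=
  ∫ w, periodogram (fun t => Y t w) N ω ∂μ

/-- The pseudo-likelihood
`ℓ_M(γ) = (1 / N) ∑_{ω ∈ Ω_N} (log S̄_Y(ω; γ) + Ŝ_Y(ω) / S̄_Y(ω; γ))`, where `y` is the observed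
path and `S̄_Y(ω; γ)` is the expectation under `P γ` of the periodogram of `Y`. -/
def pseudoLikelihood {Ω E : Type*} [MeasurableSpace Ω] (P : E → Measure Ω)
    (Y : ℕ → Ω → ℝ) (N : ℕ) (y : ℕ → ℝ) (γ : E) : ℝ :=
  (1 / (N : ℝ)) * ∑ ω ∈ fourierFrequencies N,
    (Real.log (expectedPeriodogram Y (P γ) N ω) +
      periodogram y N ω / expectedPeriodogram Y (P γ) N ω)

/-- `γ` is a minimiser over `Θ` of the pseudo-likelihood of the sample `y_0, …, y_{N-1}`. -/
def IsSpectralEstimate {Ω E : Type*} [MeasurableSpace Ω] (Θ : Set E) (P : E → Measure Ω)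
    (Y : ℕ → Ω → ℝ) (N : ℕ) (y : ℕ → ℝ) (γ : E) : Prop :=
  γ ∈ Θ ∧ IsMinOn (pseudoLikelihood P Y N y) Θ γ

end ModulatedSeries

end

namespace ModulatedSeries

section

/-! ### Fourth moments of Gaussian variables -/

/-! The likelihood is a Whittle-type contrast. For fixed `a > 0`, the function `b ↦ log b + a / b`
is minimal exactly at `b = a`. With `a`, `b` the expected periodograms at the true parameter and at
`γ`, the difference of the likelihoods is the mean of `log b + a / b - log a - 1`, plus a difference
of centred weighted periodogram means with weights `1 / b` and `1 / a`. A minimiser far from the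
truth is excluded once the first part is bounded below and the second is small uniformly in `γ`.

Lower bound: by `sq_sub_div_le_log` the divergence dominates the mean square of `a - b`. The
expected periodogram is a trigonometric polynomial whose cosine coefficient at lag `τ` on the
Fourier grid is `c_g(τ) c_X(τ)` up to `O(1/N)`. A gap between the autocovariances at one lag of `Γ`
therefore survives in quadratic mean (`eventually_le_sum_trigPoly_sq`), and injectivity with
compactness supplies such a gap uniformly away from the truth.

Law of large numbers: for bounded deterministic weights a centred mean has second moment `O(1/N)`,
by the Isserlis formula, discrete Parseval and square summability of the autocovariance
(`integral_centredMean_sq_le`).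

Uniformity: a Toeplitz form is controlled by the supremum of its symbol. Uniform continuity of the
spectral density thus makes the expected periodograms equicontinuous in `γ`, uniformly in `N` and
`ω`, and they stay between positive constants for large `N`. A finite net of parameters then
suffices. -/

theorem integral_pow_four_gaussianReal (v : NNReal) :
    ∫ x, x ^ 4 ∂(gaussianReal 0 v) = 3 * (v : ℝ) ^ 2 := by
  have h0 : (0 : ℝ) ∈ interior (integrableExpSet id (gaussianReal 0 v)) := by
    simp [integrableExpSet_id_gaussianReal]
  have h := iteratedDeriv_mgf_zero h0 4
  -- Differentiation preserves the shape polynomial times `exp (v t² / 2)`. Four applications to the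
  -- moment generating function give the fourth moment.
  have e : ∀ (p q : ℝ → ℝ) (t : ℝ), (∀ s, HasDerivAt p (q s) s) →
      HasDerivAt (fun t => p t * Real.exp (v * t ^ 2 / 2))
        ((q t + p t * (v * t)) * Real.exp (v * t ^ 2 / 2)) t := by
    intro p q t hp
    have h1 : HasDerivAt (fun t : ℝ => (v : ℝ) * t ^ 2 / 2) (v * t) t := by
      refine (((hasDerivAt_pow 2 t).const_mul (v : ℝ)).div_const 2).congr_deriv ?_
      norm_num
      ring
    refine ((hp t).mul h1.exp).congr_deriv ?_
    ring
  have m : mgf id (gaussianReal 0 v) = fun t => 1 * Real.exp (v * t ^ 2 / 2) := by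
    rw [mgf_id_gaussianReal]; ext t; simp
  have d1 : deriv (mgf id (gaussianReal 0 v)) =
      fun t => (v * t) * Real.exp (v * t ^ 2 / 2) := by
    rw [m]; ext t
    rw [(e (fun _ => 1) (fun _ => 0) t (fun s => hasDerivAt_const s 1)).deriv]; ring
  have d2 : deriv (fun t : ℝ => (v * t) * Real.exp (v * t ^ 2 / 2)) =
      fun t : ℝ => (v + v ^ 2 * t ^ 2) * Real.exp (v * t ^ 2 / 2) := by
    ext t
    rw [(e (fun t => v * t) (fun _ => v) t
      (fun s => by simpa using (hasDerivAt_id s).const_mul (v : ℝ))).deriv]; ring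
  have d3 : deriv (fun t : ℝ => (v + v ^ 2 * t ^ 2) * Real.exp (v * t ^ 2 / 2)) =
      fun t : ℝ => (3 * v ^ 2 * t + v ^ 3 * t ^ 3) * Real.exp (v * t ^ 2 / 2) := by
    ext t
    rw [(e (fun t : ℝ => v + v ^ 2 * t ^ 2) (fun t => 2 * v ^ 2 * t) t (fun s => by
      refine (((hasDerivAt_pow 2 s).const_mul ((v : ℝ) ^ 2)).const_add (v : ℝ)).congr_deriv ?_
      norm_num
      ring)).deriv]
    ring
  have d4 : deriv (fun t : ℝ => (3 * v ^ 2 * t + v ^ 3 * t ^ 3) * Real.exp (v * t ^ 2 / 2)) 0 =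
      3 * (v : ℝ) ^ 2 := by
    rw [(e (fun t : ℝ => 3 * v ^ 2 * t + v ^ 3 * t ^ 3)
      (fun t => 3 * v ^ 2 + 3 * v ^ 3 * t ^ 2) 0 (fun s => by
      refine (((hasDerivAt_id s).const_mul (3 * (v : ℝ) ^ 2)).add
        ((hasDerivAt_pow 3 s).const_mul ((v : ℝ) ^ 3))).congr_deriv ?_
      norm_num
      ring)).deriv]
    simp
  rw [iteratedDeriv_succ, iteratedDeriv_succ, iteratedDeriv_succ, iteratedDeriv_one, d1, d2, d3,
    d4] at h
  simpa using h.symm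

variable {Ω : Type*} [MeasurableSpace Ω] {μ : Measure Ω}

theorem integral_pow_four_of_hasGaussianLaw {Z : Ω → ℝ} (hZ : HasGaussianLaw Z μ)
    (h0 : ∫ w, Z w ∂μ = 0) : ∫ w, Z w ^ 4 ∂μ = 3 * (∫ w, Z w ^ 2 ∂μ) ^ 2 := by
  have := hZ.isProbabilityMeasure
  have hv : Var[Z; μ] = ∫ w, Z w ^ 2 ∂μ := by
    rw [variance_of_integral_eq_zero hZ.aemeasurable h0]
  have hmap := hZ.map_eq_gaussianReal
  rw [h0] at hmap
  have h := integral_pow_four_gaussianReal Var[Z; μ].toNNReal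
  rw [← hmap, integral_map hZ.aemeasurable (by fun_prop), Real.coe_toNNReal _ (variance_nonneg _ _),
    hv] at h
  exact h

theorem integrable_sq_mul_sq_of_hasGaussianLaw {U V : Ω → ℝ} (hU : HasGaussianLaw U μ)
    (hV : HasGaussianLaw V μ) : Integrable (fun w => U w ^ 2 * V w ^ 2) μ := by
  have := hU.isProbabilityMeasure
  have h4 : ∀ {Z : Ω → ℝ}, HasGaussianLaw Z μ → Integrable (fun w => Z w ^ 4) μ := by
    intro Z hZ
    have := (hZ.memLp (p := 4) (by simp)).integrable_norm_pow (p := 4) (by norm_num)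
    refine this.congr (ae_of_all _ fun w => ?_)
    simp only [Real.norm_eq_abs]
    exact Even.pow_abs (by decide) _
  refine ((h4 hU).add (h4 hV)).mono'
    ((hU.aemeasurable.pow_const 2).mul (hV.aemeasurable.pow_const 2)).aestronglyMeasurable
    (ae_of_all _ fun w => ?_)
  rw [Real.norm_of_nonneg (by positivity)]
  simp only [Pi.add_apply]
  nlinarith [sq_nonneg (U w ^ 2 - V w ^ 2), sq_nonneg (U w ^ 2), sq_nonneg (V w ^ 2)]

theorem integrable_mul_of_hasGaussianLaw {U V : Ω → ℝ} (hU : HasGaussianLaw U μ)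
    (hV : HasGaussianLaw V μ) : Integrable (fun w => U w * V w) μ :=
  hU.memLp_two.integrable_mul hV.memLp_two

theorem integrable_sq_of_hasGaussianLaw {U : Ω → ℝ} (hU : HasGaussianLaw U μ) :
    Integrable (fun w => U w ^ 2) μ :=
  hU.memLp_two.integrable_sq

/-- The Isserlis formula for `E[U² V²]`. -/
theorem integral_sq_mul_sq_of_hasGaussianLaw {U V : Ω → ℝ} (hU : HasGaussianLaw U μ)
    (hV : HasGaussianLaw V μ) (hadd : HasGaussianLaw (fun w => U w + V w) μ)
    (hsub : HasGaussianLaw (fun w => U w - V w) μ)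
    (hU0 : ∫ w, U w ∂μ = 0) (hV0 : ∫ w, V w ∂μ = 0) :
    ∫ w, U w ^ 2 * V w ^ 2 ∂μ =
      (∫ w, U w ^ 2 ∂μ) * (∫ w, V w ^ 2 ∂μ) + 2 * (∫ w, U w * V w ∂μ) ^ 2 := by
  have h1 := integral_pow_four_of_hasGaussianLaw hU hU0
  have h2 := integral_pow_four_of_hasGaussianLaw hV hV0
  have h3 := integral_pow_four_of_hasGaussianLaw hadd (by
    rw [integral_add hU.integrable hV.integrable, hU0, hV0, add_zero])
  have h4 := integral_pow_four_of_hasGaussianLaw hsub (by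
    rw [integral_sub hU.integrable hV.integrable, hU0, hV0, sub_zero])
  have iU2 := integrable_sq_of_hasGaussianLaw hU
  have iV2 := integrable_sq_of_hasGaussianLaw hV
  have iUV := integrable_mul_of_hasGaussianLaw hU hV
  have i22 := integrable_sq_mul_sq_of_hasGaussianLaw hU hV
  have e4 : ∀ {Z : Ω → ℝ}, HasGaussianLaw Z μ → Integrable (fun w => Z w ^ 4) μ := by
    intro Z hZ
    refine (integrable_sq_mul_sq_of_hasGaussianLaw hZ hZ).congr (ae_of_all _ fun w => ?_)
    ring
  have s3 : ∫ w, (U w + V w) ^ 2 ∂μ =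
      ∫ w, U w ^ 2 ∂μ + 2 * ∫ w, U w * V w ∂μ + ∫ w, V w ^ 2 ∂μ := by
    have i3 : Integrable (fun w => U w ^ 2 + 2 * (U w * V w)) μ := iU2.add (iUV.const_mul 2)
    rw [← integral_const_mul, ← integral_add iU2 (iUV.const_mul 2), ← integral_add i3 iV2]
    congr 1; ext w; ring
  have s4 : ∫ w, (U w - V w) ^ 2 ∂μ =
      ∫ w, U w ^ 2 ∂μ - 2 * ∫ w, U w * V w ∂μ + ∫ w, V w ^ 2 ∂μ := by
    have i3 : Integrable (fun w => U w ^ 2 - 2 * (U w * V w)) μ := iU2.sub (iUV.const_mul 2)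
    rw [← integral_const_mul, ← integral_sub iU2 (iUV.const_mul 2), ← integral_add i3 iV2]
    congr 1; ext w; ring
  -- Polarisation: `(U + V)⁴ + (U - V)⁴` contains `U² V²` and no odd mixed terms, so the
  -- one-dimensional fourth moments of `U`, `V`, `U + V`, `U - V` determine the mixed one.
  have key : ∫ w, (U w + V w) ^ 4 ∂μ + ∫ w, (U w - V w) ^ 4 ∂μ =
      2 * ∫ w, U w ^ 4 ∂μ + 2 * ∫ w, V w ^ 4 ∂μ + 12 * ∫ w, U w ^ 2 * V w ^ 2 ∂μ := by
    have i3 : Integrable (fun w => 2 * U w ^ 4 + 2 * V w ^ 4) μ :=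
      ((e4 hU).const_mul 2).add ((e4 hV).const_mul 2)
    rw [← integral_add (e4 hadd) (e4 hsub), ← integral_const_mul, ← integral_const_mul,
      ← integral_const_mul, ← integral_add ((e4 hU).const_mul 2) ((e4 hV).const_mul 2),
      ← integral_add i3 (i22.const_mul 12)]
    congr 1; ext w; ring
  rw [h1, h2, h3, h4, s3, s4] at key
  linarith

/-- The variance of a weighted sum of squares of jointly Gaussian centred variables. -/
theorem integral_sq_weighted_sum_sq {ι : Type*} (K : Finset ι) (φ : ι → ℝ) (U : ι → Ω → ℝ)
    [IsProbabilityMeasure μ]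
    (hU : ∀ i, HasGaussianLaw (U i) μ) (h0 : ∀ i, ∫ w, U i w ∂μ = 0)
    (hadd : ∀ i j, HasGaussianLaw (fun w => U i w + U j w) μ)
    (hsub : ∀ i j, HasGaussianLaw (fun w => U i w - U j w) μ) :
    Integrable (fun w => (∑ i ∈ K, φ i * (U i w ^ 2 - ∫ x, U i x ^ 2 ∂μ)) ^ 2) μ ∧
    ∫ w, (∑ i ∈ K, φ i * (U i w ^ 2 - ∫ x, U i x ^ 2 ∂μ)) ^ 2 ∂μ =
      2 * ∑ i ∈ K, ∑ j ∈ K, φ i * φ j * (∫ w, U i w * U j w ∂μ) ^ 2 := by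
  have i2 := fun i => integrable_sq_of_hasGaussianLaw (hU i)
  have i22 := fun i j => integrable_sq_mul_sq_of_hasGaussianLaw (hU i) (hU j)
  have hprod : ∀ i j, (fun w => (U i w ^ 2 - ∫ x, U i x ^ 2 ∂μ) * (U j w ^ 2 - ∫ x, U j x ^ 2 ∂μ)) =
      fun w => ((U i w ^ 2 * U j w ^ 2 - (∫ x, U j x ^ 2 ∂μ) * U i w ^ 2) -
        (∫ x, U i x ^ 2 ∂μ) * U j w ^ 2) + (∫ x, U i x ^ 2 ∂μ) * (∫ x, U j x ^ 2 ∂μ) := by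
    intro i j; ext w; ring
  have hinteg : ∀ i j, Integrable
      (fun w => (U i w ^ 2 - ∫ x, U i x ^ 2 ∂μ) * (U j w ^ 2 - ∫ x, U j x ^ 2 ∂μ)) μ := by
    intro i j
    rw [hprod]
    exact (((i22 i j).sub ((i2 i).const_mul _)).sub ((i2 j).const_mul _)).add (integrable_const _)
  -- By Isserlis, the covariance of two squares is twice the squared covariance.
  have hval : ∀ i j,
      ∫ w, (U i w ^ 2 - ∫ x, U i x ^ 2 ∂μ) * (U j w ^ 2 - ∫ x, U j x ^ 2 ∂μ) ∂μ =
      2 * (∫ w, U i w * U j w ∂μ) ^ 2 := by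
    intro i j
    have j1 : Integrable (fun w => U i w ^ 2 * U j w ^ 2 - (∫ x, U j x ^ 2 ∂μ) * U i w ^ 2) μ :=
      (i22 i j).sub ((i2 i).const_mul _)
    have j2 : Integrable (fun w => U i w ^ 2 * U j w ^ 2 - (∫ x, U j x ^ 2 ∂μ) * U i w ^ 2 -
        (∫ x, U i x ^ 2 ∂μ) * U j w ^ 2) μ := j1.sub ((i2 j).const_mul _)
    rw [hprod, integral_add j2 (integrable_const _), integral_sub j1 ((i2 j).const_mul _),
      integral_sub (i22 i j) ((i2 i).const_mul _), integral_const_mul, integral_const_mul,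
      integral_sq_mul_sq_of_hasGaussianLaw (hU i) (hU j) (hadd i j) (hsub i j) (h0 i) (h0 j)]
    simp
    ring
  have hexp : (fun w => (∑ i ∈ K, φ i * (U i w ^ 2 - ∫ x, U i x ^ 2 ∂μ)) ^ 2) =
      fun w => ∑ i ∈ K, ∑ j ∈ K, φ i * φ j *
        ((U i w ^ 2 - ∫ x, U i x ^ 2 ∂μ) * (U j w ^ 2 - ∫ x, U j x ^ 2 ∂μ)) := by
    ext w
    rw [sq, Finset.sum_mul_sum]
    refine Finset.sum_congr rfl fun i _ => Finset.sum_congr rfl fun j _ => ?_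
    ring
  rw [hexp]
  refine ⟨integrable_finsetSum _ fun i _ => integrable_finsetSum _ fun j _ =>
    (hinteg i j).const_mul _, ?_⟩
  rw [integral_finsetSum _ fun i _ => integrable_finsetSum _ fun j _ => (hinteg i j).const_mul _,
    Finset.mul_sum]
  refine Finset.sum_congr rfl fun i _ => ?_
  rw [integral_finsetSum _ fun j _ => (hinteg i j).const_mul _, Finset.mul_sum]
  refine Finset.sum_congr rfl fun j _ => ?_
  rw [integral_const_mul, hval]
  ring

/-! ### Linear forms in a stationary Gaussian process -/

/-- The linear form `∑_{t < N} a_t X_t`. -/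
def linearForm {Ω : Type*} (X : ℕ → Ω → ℝ) (N : ℕ) (a : ℕ → ℝ) (w : Ω) : ℝ :=
  ∑ t ∈ Finset.range N, a t * X t w

theorem linearForm_add {Ω : Type*} (X : ℕ → Ω → ℝ) (N : ℕ) (a b : ℕ → ℝ) (w : Ω) :
    linearForm X N a w + linearForm X N b w = linearForm X N (a + b) w := by
  simp only [linearForm, Pi.add_apply, ← Finset.sum_add_distrib, add_mul]

theorem linearForm_sub {Ω : Type*} (X : ℕ → Ω → ℝ) (N : ℕ) (a b : ℕ → ℝ) (w : Ω) :
    linearForm X N a w - linearForm X N b w = linearForm X N (a - b) w := by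
  simp only [linearForm, Pi.sub_apply, ← Finset.sum_sub_distrib, sub_mul]

variable {X : ℕ → Ω → ℝ}

theorem IsStationaryGaussian.isProbabilityMeasure (h : IsStationaryGaussian X μ) :
    IsProbabilityMeasure μ :=
  h.gaussian.isProbabilityMeasure

theorem IsStationaryGaussian.hasGaussianLaw_linearForm (h : IsStationaryGaussian X μ) (N : ℕ)
    (a : ℕ → ℝ) : HasGaussianLaw (linearForm X N a) μ := by
  have := (h.gaussian.smul a).hasGaussianLaw_fun_sum (I := Finset.range N)
  exact this

theorem IsStationaryGaussian.integral_linearForm (h : IsStationaryGaussian X μ) (N : ℕ)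
    (a : ℕ → ℝ) : ∫ w, linearForm X N a w ∂μ = 0 := by
  unfold linearForm
  rw [integral_finsetSum _ fun t _ => ((h.gaussian.hasGaussianLaw_eval t).integrable.const_mul _)]
  simp [integral_const_mul, h.mean_zero]

theorem IsStationaryGaussian.integral_mul (h : IsStationaryGaussian X μ) (s t : ℕ) :
    ∫ w, X s w * X t w ∂μ = autocov X μ ((s : ℤ) - t).natAbs := by
  have := h.isProbabilityMeasure
  have key : ∀ s t, s ≤ t → ∫ w, X s w * X t w ∂μ = autocov X μ (t - s) := by
    intro s t hst
    have h1 := h.stationary s (t - s)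
    rw [Nat.add_sub_cancel' hst, covariance_eq_sub (h.gaussian.hasGaussianLaw_eval s).memLp_two
      (h.gaussian.hasGaussianLaw_eval t).memLp_two, h.mean_zero s] at h1
    simpa [autocov] using h1
  rcases le_total s t with hst | hst
  · rw [key s t hst]; congr 1; omega
  · simp_rw [mul_comm (X s _)]
    rw [key t s hst]; congr 1; omega

theorem IsStationaryGaussian.integral_linearForm_mul (h : IsStationaryGaussian X μ) (N : ℕ)
    (a b : ℕ → ℝ) : ∫ w, linearForm X N a w * linearForm X N b w ∂μ =
      ∑ s ∈ Finset.range N, ∑ t ∈ Finset.range N,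
        a s * b t * autocov X μ ((s : ℤ) - t).natAbs := by
  have hinteg : ∀ s t, Integrable (fun w => X s w * X t w) μ := fun s t =>
    integrable_mul_of_hasGaussianLaw (h.gaussian.hasGaussianLaw_eval s)
      (h.gaussian.hasGaussianLaw_eval t)
  have : (fun w => linearForm X N a w * linearForm X N b w) =
      fun w => ∑ s ∈ Finset.range N, ∑ t ∈ Finset.range N, a s * b t * (X s w * X t w) := by
    ext w
    rw [linearForm, linearForm, Finset.sum_mul_sum]
    refine Finset.sum_congr rfl fun i _ => Finset.sum_congr rfl fun j _ => ?_
    ring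
  rw [this, integral_finsetSum _ fun s _ => integrable_finsetSum _ fun t _ =>
    (hinteg s t).const_mul _]
  refine Finset.sum_congr rfl fun s _ => ?_
  rw [integral_finsetSum _ fun t _ => (hinteg s t).const_mul _]
  refine Finset.sum_congr rfl fun t _ => ?_
  rw [integral_const_mul, h.integral_mul]

end

section

/-! ### Orthogonality on the Fourier frequencies -/

/-- Since `⌈N/2⌉ + ⌊N/2⌋ = N`, the frequencies are `N` consecutive multiples of `2π / N`. -/
theorem sum_fourierFrequencies {M : Type*} [AddCommMonoid M] {N : ℕ} (hN : 0 < N) (f : ℝ → M) :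
    ∑ ω ∈ fourierFrequencies N, f ω = ∑ j ∈ Finset.range N,
      f (2 * π / N * ((-(((N + 1) / 2 : ℕ) : ℤ) + 1 + j : ℤ) : ℝ)) := by
  have hN' : (0 : ℝ) < N := by exact_mod_cast hN
  unfold fourierFrequencies
  rw [Finset.sum_image]
  · refine Finset.sum_nbij' (fun k => (k + (((N + 1) / 2 : ℕ) : ℤ) - 1).toNat)
      (fun j => -(((N + 1) / 2 : ℕ) : ℤ) + 1 + j) ?_ ?_ ?_ ?_ ?_
    · intro k hk
      simp only [Finset.mem_Icc, Finset.mem_range] at hk ⊢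
      omega
    · intro k hk
      simp only [Finset.mem_Icc, Finset.mem_range] at hk ⊢
      omega
    · intro k hk
      simp only [Finset.mem_Icc] at hk
      omega
    · intro k hk
      simp only [Finset.mem_range] at hk
      omega
    · intro k hk
      simp only [Finset.mem_Icc] at hk
      congr 3
      omega
  · intro a _ b _ hab
    have : (2 * π / (N : ℝ)) ≠ 0 := by positivity
    exact_mod_cast mul_left_cancel₀ this hab

theorem card_fourierFrequencies {N : ℕ} (hN : 0 < N) : (fourierFrequencies N).card = N := by
  rw [Finset.card_eq_sum_ones, sum_fourierFrequencies hN]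
  simp

/-- The sum is the real part of a geometric sum of an `N`-th root of unity `z`, and `z = 1` exactly
when `N` divides `n`. -/
theorem sum_cos_fourierFrequencies {N : ℕ} (hN : 0 < N) (n : ℤ) :
    ∑ ω ∈ fourierFrequencies N, Real.cos (ω * n) = if (N : ℤ) ∣ n then (N : ℝ) else 0 := by
  have hN' : (N : ℂ) ≠ 0 := by exact_mod_cast hN.ne'
  rw [sum_fourierFrequencies hN]
  set a : ℤ := -(((N + 1) / 2 : ℕ) : ℤ) + 1
  set z : ℂ := Complex.exp (2 * π * Complex.I * (n / N)) with hz
  have hcos : ∀ j : ℕ, Real.cos (2 * π / N * ((a + j : ℤ) : ℝ) * n) = (z ^ a * z ^ j).re := by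
    intro j
    rw [← zpow_natCast, ← zpow_add₀ (Complex.exp_ne_zero _), ← Complex.exp_int_mul,
      ← Complex.exp_ofReal_mul_I_re]
    congr 2
    push_cast
    ring
  rw [Finset.sum_congr rfl fun j _ => hcos j, ← Complex.re_sum, ← Finset.mul_sum]
  split_ifs with hd
  · obtain ⟨m, rfl⟩ := hd
    have : z = 1 := by
      rw [hz, Complex.exp_eq_one_iff]
      refine ⟨m, ?_⟩
      push_cast
      field_simp
    simp [this]
  · have hz1 : z ≠ 1 := by
      rw [hz, Ne, Complex.exp_eq_one_iff]
      rintro ⟨m, hm⟩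
      apply hd
      refine ⟨m, ?_⟩
      have h2 : (2 * π * Complex.I : ℂ) ≠ 0 := Complex.two_pi_I_ne_zero
      rw [mul_comm (m : ℂ)] at hm
      have h3 := mul_left_cancel₀ h2 hm
      rw [div_eq_iff hN', mul_comm] at h3
      exact_mod_cast h3
    have hzN : z ^ N = 1 := by
      rw [hz, ← Complex.exp_nat_mul, Complex.exp_eq_one_iff]
      refine ⟨n, ?_⟩
      field_simp
    rw [geom_sum_eq hz1, hzN]
    simp

/-- The cosine and sine vectors of frequency `ω`. -/
noncomputable def trigVec (ω : ℝ) (b : Bool) (t : ℕ) : ℝ :=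
  if b then Real.cos (ω * t) else Real.sin (ω * t)

theorem sum_trigVec_mul (ω : ℝ) (s t : ℕ) :
    ∑ b : Bool, trigVec ω b s * trigVec ω b t = Real.cos (ω * ((s : ℤ) - t : ℤ)) := by
  simp [trigVec, mul_sub, Real.cos_sub]

/-- The Parseval identity on the Fourier frequencies. -/
theorem sum_sq_trigVec {N : ℕ} (hN : 0 < N) (x : ℕ → ℝ) :
    ∑ k ∈ fourierFrequencies N ×ˢ (Finset.univ : Finset Bool),
      (∑ s ∈ Finset.range N, trigVec k.1 k.2 s * x s) ^ 2 =
      N * ∑ s ∈ Finset.range N, x s ^ 2 := by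
  have hexp : ∀ k : ℝ × Bool, (∑ s ∈ Finset.range N, trigVec k.1 k.2 s * x s) ^ 2 =
      ∑ s ∈ Finset.range N, ∑ t ∈ Finset.range N,
        x s * x t * (trigVec k.1 k.2 s * trigVec k.1 k.2 t) := by
    intro k
    rw [sq, Finset.sum_mul_sum]
    refine Finset.sum_congr rfl fun i _ => Finset.sum_congr rfl fun j _ => ?_
    ring
  rw [Finset.sum_congr rfl fun k _ => hexp k, Finset.sum_comm, Finset.mul_sum]
  refine Finset.sum_congr rfl fun s hs => ?_
  rw [Finset.sum_comm]
  have horth : ∀ t ∈ Finset.range N, ∑ k ∈ fourierFrequencies N ×ˢ (Finset.univ : Finset Bool),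
      x s * x t * (trigVec k.1 k.2 s * trigVec k.1 k.2 t) = if s = t then N * x s ^ 2 else 0 := by
    intro t ht
    rw [← Finset.mul_sum, Finset.sum_product]
    simp_rw [sum_trigVec_mul]
    rw [sum_cos_fourierFrequencies hN]
    simp only [Finset.mem_range] at hs ht
    by_cases hst : s = t
    · subst hst; simp; ring
    · rw [if_neg, if_neg hst, mul_zero]
      intro hd
      apply hst
      have := Int.eq_zero_of_abs_lt_dvd hd (by rw [abs_lt]; constructor <;> omega)
      omega
  rw [Finset.sum_congr rfl horth, Finset.sum_ite_eq, if_pos hs]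

/-- The Parseval identity for bilinear forms on the Fourier frequencies. -/
theorem sum_sq_bilin_trigVec {N : ℕ} (hN : 0 < N) (m : ℕ → ℕ → ℝ) :
    ∑ k ∈ fourierFrequencies N ×ˢ (Finset.univ : Finset Bool),
      ∑ l ∈ fourierFrequencies N ×ˢ (Finset.univ : Finset Bool),
        (∑ s ∈ Finset.range N, ∑ t ∈ Finset.range N,
          trigVec k.1 k.2 s * trigVec l.1 l.2 t * m s t) ^ 2 =
      N ^ 2 * ∑ s ∈ Finset.range N, ∑ t ∈ Finset.range N, m s t ^ 2 := by
  have h1 : ∀ k l : ℝ × Bool, ∑ s ∈ Finset.range N, ∑ t ∈ Finset.range N,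
      trigVec k.1 k.2 s * trigVec l.1 l.2 t * m s t =
      ∑ t ∈ Finset.range N, trigVec l.1 l.2 t *
        ∑ s ∈ Finset.range N, trigVec k.1 k.2 s * m s t := by
    intro k l
    rw [Finset.sum_comm]
    refine Finset.sum_congr rfl fun t _ => ?_
    rw [Finset.mul_sum]
    refine Finset.sum_congr rfl fun s _ => ?_
    ring
  simp_rw [h1, sum_sq_trigVec hN]
  rw [← Finset.mul_sum, Finset.sum_comm]
  simp_rw [sum_sq_trigVec hN]
  rw [← Finset.mul_sum, ← mul_assoc, ← sq, Finset.sum_comm]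

/-! ### The periodogram as a quadratic form -/

/-- The quadratic form `∑_{s,t<N} a_s a_t c(|s - t|)`. -/
def toeplitzForm (c : ℕ → ℝ) (N : ℕ) (a : ℕ → ℝ) : ℝ :=
  ∑ s ∈ Finset.range N, ∑ t ∈ Finset.range N, a s * a t * c ((s : ℤ) - t).natAbs

theorem periodogram_eq (y : ℕ → ℝ) (N : ℕ) (ω : ℝ) :
    periodogram y N ω = 1 / N * ∑ b : Bool, (∑ t ∈ Finset.range N, trigVec ω b t * y t) ^ 2 := by
  have h : ∑ t ∈ Finset.range N, (y t : ℂ) * Complex.exp (-Complex.I * (ω : ℂ) * (t : ℂ)) =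
      ((∑ t ∈ Finset.range N, trigVec ω true t * y t : ℝ) : ℂ) -
        ((∑ t ∈ Finset.range N, trigVec ω false t * y t : ℝ) : ℂ) * Complex.I := by
    push_cast
    rw [Finset.sum_mul, ← Finset.sum_sub_distrib]
    refine Finset.sum_congr rfl fun t _ => ?_
    rw [show -Complex.I * (ω : ℂ) * (t : ℂ) = ((-(ω * t) : ℝ) : ℂ) * Complex.I by push_cast; ring,
      Complex.exp_mul_I, ← Complex.ofReal_cos, ← Complex.ofReal_sin, Real.cos_neg, Real.sin_neg]
    simp only [trigVec, if_true, Bool.false_eq_true, if_false]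
    push_cast
    ring
  rw [periodogram, h, ← Complex.normSq_eq_norm_sq, Complex.normSq_apply]
  simp only [Complex.sub_re, Complex.ofReal_re, Complex.mul_re, Complex.I_re, Complex.ofReal_im,
    Complex.I_im, Complex.sub_im, Complex.mul_im, Fintype.sum_bool]
  ring

variable {Ω : Type*} [MeasurableSpace Ω] {μ : Measure Ω} {X : ℕ → Ω → ℝ}

theorem periodogram_modulate {Ω : Type*} (g : ℕ → ℝ) (X : ℕ → Ω → ℝ) (N : ℕ) (ω : ℝ) (w : Ω) :
    periodogram (fun t => modulate g X t w) N ω =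
      1 / N * ∑ b : Bool, linearForm X N (fun t => trigVec ω b t * g t) w ^ 2 := by
  rw [periodogram_eq]
  simp only [linearForm, modulate, mul_assoc]

theorem periodogram_nonneg (y : ℕ → ℝ) (N : ℕ) (ω : ℝ) : 0 ≤ periodogram y N ω := by
  unfold periodogram; positivity

theorem expectedPeriodogram_eq (h : IsStationaryGaussian X μ) (g : ℕ → ℝ) (N : ℕ) (ω : ℝ) :
    expectedPeriodogram (modulate g X) μ N ω =
      1 / N * ∑ b : Bool, ∫ w, linearForm X N (fun t => trigVec ω b t * g t) w ^ 2 ∂μ := by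
  simp only [expectedPeriodogram, periodogram_modulate]
  rw [integral_const_mul, integral_finsetSum _ fun b _ =>
    integrable_sq_of_hasGaussianLaw (h.hasGaussianLaw_linearForm N _)]

theorem expectedPeriodogram_eq_toeplitzForm (h : IsStationaryGaussian X μ) (g : ℕ → ℝ) (N : ℕ)
    (ω : ℝ) : expectedPeriodogram (modulate g X) μ N ω =
      1 / N * ∑ b : Bool, toeplitzForm (autocov X μ) N (fun t => trigVec ω b t * g t) := by
  rw [expectedPeriodogram_eq h]
  simp_rw [sq, h.integral_linearForm_mul]
  rfl

theorem sum_toeplitzForm_trigVec (c : ℕ → ℝ) (g : ℕ → ℝ) (N : ℕ) (ω : ℝ) :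
    ∑ b : Bool, toeplitzForm c N (fun t => trigVec ω b t * g t) =
      ∑ s ∈ Finset.range N, ∑ t ∈ Finset.range N,
        g s * g t * c ((s : ℤ) - t).natAbs * Real.cos (ω * ((s : ℤ) - t : ℤ)) := by
  unfold toeplitzForm
  rw [Finset.sum_comm]
  refine Finset.sum_congr rfl fun s _ => ?_
  rw [Finset.sum_comm]
  refine Finset.sum_congr rfl fun t _ => ?_
  rw [← sum_trigVec_mul, Finset.mul_sum]
  refine Finset.sum_congr rfl fun b _ => ?_
  ring

/-! ### The law of large numbers for weighted periodogram sums -/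

/-- The centred weighted mean of the periodogram over the Fourier frequencies. -/
noncomputable def centredMean (g : ℕ → ℝ) (X : ℕ → Ω → ℝ) (μ : Measure Ω) (N : ℕ) (φ : ℝ → ℝ)
    (w : Ω) : ℝ :=
  1 / N * ∑ ω ∈ fourierFrequencies N, φ ω * (periodogram (fun t => modulate g X t w) N ω -
    expectedPeriodogram (modulate g X) μ N ω)

/-- Each value of `|s - t|` occurs at most twice, once with `t ≤ s` and once with `t > s`. Squares
are summable because an absolutely summable sequence is bounded. -/
theorem sum_sq_natAbs_sub_le {c : ℕ → ℝ} (hc : Summable fun τ => |c τ|) (N s : ℕ) :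
    ∑ t ∈ Finset.range N, c ((s : ℤ) - t).natAbs ^ 2 ≤ 2 * ∑' τ, c τ ^ 2 := by
  have hc2 : Summable fun τ => c τ ^ 2 := by
    refine Summable.of_nonneg_of_le (fun τ => sq_nonneg _) (fun τ => ?_)
      (hc.mul_left (∑' τ, |c τ|))
    rw [← sq_abs, sq]
    exact mul_le_mul_of_nonneg_right (hc.le_tsum τ fun _ _ => abs_nonneg _) (abs_nonneg _)
  have hinj : ∀ A : Finset ℕ, InjOn (fun t : ℕ => ((s : ℤ) - t).natAbs) A →
      ∑ t ∈ A, c ((s : ℤ) - t).natAbs ^ 2 ≤ ∑' τ, c τ ^ 2 := by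
    intro A hA
    rw [← Finset.sum_image (f := fun τ => c τ ^ 2) hA]
    exact hc2.sum_le_tsum _ fun _ _ => sq_nonneg _
  rw [← Finset.sum_filter_add_sum_filter_not (Finset.range N) (fun t => t ≤ s), two_mul]
  refine add_le_add (hinj _ ?_) (hinj _ ?_) <;>
  · intro a ha b hb hab
    simp only [Finset.coe_filter, Finset.mem_range, mem_ofPred_eq] at ha hb hab
    omega

/-- The periodogram is a sum of squares of the Gaussian forms `U k`, so the variance is a double sum
of `φ φ` times squared covariances. As those squares are nonnegative, the weights may be replaced by
`K²`. Parseval then leaves `N²` times the sum of `(g s g t c(|s - t|))²`, which is only `O(N)` and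
beats the prefactor `1 / N⁴`. -/
theorem integral_centredMean_sq_le (h : IsStationaryGaussian X μ)
    (hc : Summable fun τ => |autocov X μ τ|) {g : ℕ → ℝ} {G : ℝ} (hg : ∀ t, |g t| ≤ G)
    {N : ℕ} (hN : 0 < N) {φ : ℝ → ℝ} {K : ℝ}
    (hφ : ∀ ω ∈ fourierFrequencies N, |φ ω| ≤ K) :
    Integrable (fun w => centredMean g X μ N φ w ^ 2) μ ∧
    ∫ w, centredMean g X μ N φ w ^ 2 ∂μ ≤
      4 * G ^ 4 * (∑' τ, autocov X μ τ ^ 2) * K ^ 2 / N := by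
  have := h.isProbabilityMeasure
  have hN' : (0 : ℝ) < N := by exact_mod_cast hN
  set KK := fourierFrequencies N ×ˢ (Finset.univ : Finset Bool) with hKK
  set U : ℝ × Bool → Ω → ℝ := fun k => linearForm X N (fun t => trigVec k.1 k.2 t * g t) with hU
  have hform : ∀ w, centredMean g X μ N φ w =
      1 / N ^ 2 * ∑ k ∈ KK, φ k.1 * (U k w ^ 2 - ∫ x, U k x ^ 2 ∂μ) := by
    intro w
    rw [hKK, Finset.sum_product, centredMean, Finset.mul_sum, Finset.mul_sum]
    refine Finset.sum_congr rfl fun ω _ => ?_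
    rw [periodogram_modulate, expectedPeriodogram_eq h]
    simp only
    rw [← Finset.mul_sum, Finset.sum_sub_distrib]
    field_simp
    rfl
  obtain ⟨hinteg, hval⟩ := integral_sq_weighted_sum_sq (μ := μ) KK (fun k => φ k.1) U
    (fun k => h.hasGaussianLaw_linearForm N _) (fun k => h.integral_linearForm N _)
    (fun k l => by simp only [hU, linearForm_add]; exact h.hasGaussianLaw_linearForm N _)
    (fun k l => by simp only [hU, linearForm_sub]; exact h.hasGaussianLaw_linearForm N _)
  have hsq : (fun w => centredMean g X μ N φ w ^ 2) = fun w => 1 / (N : ℝ) ^ 4 *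
      (∑ k ∈ KK, φ k.1 * (U k w ^ 2 - ∫ x, U k x ^ 2 ∂μ)) ^ 2 := by
    ext w; rw [hform, mul_pow]; congr 1; field_simp
  rw [hsq]
  refine ⟨hinteg.const_mul _, ?_⟩
  rw [integral_const_mul, hval]
  have hcov : ∀ k l, ∫ w, U k w * U l w ∂μ = ∑ s ∈ Finset.range N, ∑ t ∈ Finset.range N,
      trigVec k.1 k.2 s * trigVec l.1 l.2 t *
        (g s * g t * autocov X μ ((s : ℤ) - t).natAbs) := by
    intro k l
    rw [hU, h.integral_linearForm_mul]
    refine Finset.sum_congr rfl fun s _ => Finset.sum_congr rfl fun t _ => ?_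
    ring
  have hG : ∀ t, g t ^ 2 ≤ G ^ 2 := fun t => sq_le_sq' (abs_le.1 (hg t)).1 (abs_le.1 (hg t)).2
  have hK : ∑ k ∈ KK, ∑ l ∈ KK, φ k.1 * φ l.1 * (∫ w, U k w * U l w ∂μ) ^ 2 ≤
      K ^ 2 * (N ^ 2 * (N * (G ^ 4 * (2 * ∑' τ, autocov X μ τ ^ 2)))) := by
    calc ∑ k ∈ KK, ∑ l ∈ KK, φ k.1 * φ l.1 * (∫ w, U k w * U l w ∂μ) ^ 2
        ≤ ∑ k ∈ KK, ∑ l ∈ KK, K ^ 2 * (∫ w, U k w * U l w ∂μ) ^ 2 := by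
          refine Finset.sum_le_sum fun k hk => Finset.sum_le_sum fun l hl => ?_
          refine mul_le_mul_of_nonneg_right ?_ (sq_nonneg _)
          have hk' := hφ k.1 (Finset.mem_product.1 hk).1
          have hl' := hφ l.1 (Finset.mem_product.1 hl).1
          calc φ k.1 * φ l.1 ≤ |φ k.1| * |φ l.1| := by rw [← abs_mul]; exact le_abs_self _
            _ ≤ K * K := mul_le_mul hk' hl' (abs_nonneg _) ((abs_nonneg _).trans hk')
            _ = K ^ 2 := (sq K).symm
      _ = K ^ 2 * (N ^ 2 * ∑ s ∈ Finset.range N, ∑ t ∈ Finset.range N,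
            (g s * g t * autocov X μ ((s : ℤ) - t).natAbs) ^ 2) := by
          simp_rw [hcov]
          rw [← sum_sq_bilin_trigVec hN, Finset.mul_sum]
          simp_rw [Finset.mul_sum]
          rfl
      _ ≤ _ := by
          gcongr
          calc ∑ s ∈ Finset.range N, ∑ t ∈ Finset.range N,
                (g s * g t * autocov X μ ((s : ℤ) - t).natAbs) ^ 2
              ≤ ∑ s ∈ Finset.range N, G ^ 4 * (2 * ∑' τ, autocov X μ τ ^ 2) := by
                refine Finset.sum_le_sum fun s _ => ?_
                calc ∑ t ∈ Finset.range N, (g s * g t * autocov X μ ((s : ℤ) - t).natAbs) ^ 2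
                    ≤ ∑ t ∈ Finset.range N, G ^ 4 * autocov X μ ((s : ℤ) - t).natAbs ^ 2 := by
                      refine Finset.sum_le_sum fun t _ => ?_
                      rw [mul_pow, mul_pow]
                      refine mul_le_mul_of_nonneg_right ?_ (sq_nonneg _)
                      calc g s ^ 2 * g t ^ 2 ≤ G ^ 2 * G ^ 2 :=
                            mul_le_mul (hG s) (hG t) (sq_nonneg _) (sq_nonneg _)
                        _ = G ^ 4 := by ring
                  _ ≤ _ := by
                      rw [← Finset.mul_sum]
                      exact mul_le_mul_of_nonneg_left (sum_sq_natAbs_sub_le hc N s) (by positivity)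
            _ = _ := by simp
  calc 1 / (N : ℝ) ^ 4 * (2 * ∑ k ∈ KK, ∑ l ∈ KK, φ k.1 * φ l.1 * (∫ w, U k w * U l w ∂μ) ^ 2)
      ≤ 1 / (N : ℝ) ^ 4 * (2 * (K ^ 2 * (N ^ 2 * (N * (G ^ 4 *
          (2 * ∑' τ, autocov X μ τ ^ 2)))))) := by gcongr
    _ = _ := by field_simp; ring

/-- Chebyshev's inequality. The weights may vary with `N` as long as they are deterministic and
eventually bounded on the grid. -/
theorem tendsto_measure_centredMean (h : IsStationaryGaussian X μ)
    (hc : Summable fun τ => |autocov X μ τ|) {g : ℕ → ℝ} {G : ℝ} (hg : ∀ t, |g t| ≤ G)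
    {φ : ℕ → ℝ → ℝ} {K : ℝ}
    (hφ : ∀ᶠ N in atTop, ∀ ω ∈ fourierFrequencies N, |φ N ω| ≤ K) {δ : ℝ} (hδ : 0 < δ) :
    Tendsto (fun N => μ {w | δ ≤ |centredMean g X μ N (φ N) w|}) atTop (𝓝 0) := by
  have := h.isProbabilityMeasure
  set C := 4 * G ^ 4 * (∑' τ, autocov X μ τ ^ 2) * K ^ 2
  have hlim : Tendsto (fun N : ℕ => ENNReal.ofReal (C / N / δ ^ 2)) atTop (𝓝 0) := by
    rw [← ENNReal.ofReal_zero]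
    refine ENNReal.tendsto_ofReal ?_
    simpa using (tendsto_const_div_atTop_nhds_zero_nat C).div_const (δ ^ 2)
  refine tendsto_of_tendsto_of_tendsto_of_le_of_le' tendsto_const_nhds hlim
    (Eventually.of_forall fun _ => zero_le) ?_
  filter_upwards [hφ, eventually_gt_atTop 0] with N hN hN0
  obtain ⟨hinteg, hle⟩ := integral_centredMean_sq_le h hc hg hN0 hN
  have hcheb := mul_meas_ge_le_integral_of_nonneg (ae_of_all _ fun w => sq_nonneg _) hinteg (δ ^ 2)
  have hset : {w | δ ≤ |centredMean g X μ N (φ N) w|} =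
      {w | δ ^ 2 ≤ centredMean g X μ N (φ N) w ^ 2} := by
    ext w
    simp only [mem_ofPred_eq]
    rw [← sq_abs (centredMean g X μ N (φ N) w), sq_le_sq₀ hδ.le (abs_nonneg _)]
  rw [hset, ← ENNReal.ofReal_toReal (measure_ne_top μ _)]
  refine ENNReal.ofReal_le_ofReal ?_
  rw [le_div_iff₀ (by positivity), mul_comm]
  exact hcheb.trans hle

end

section

/-! ### Toeplitz forms and their symbols -/

/-- The symbol `(1 / 2π) ∑_{τ ∈ ℤ} c(|τ|) cos(ωτ)` of the Toeplitz form of `c`. -/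
noncomputable def symbol (c : ℕ → ℝ) (ω : ℝ) : ℝ :=
  1 / (2 * π) * ∑' τ : ℤ, c τ.natAbs * Real.cos (ω * τ)

theorem summable_natAbs {c : ℕ → ℝ} (hc : Summable fun τ => |c τ|) :
    Summable fun τ : ℤ => |c τ.natAbs| :=
  Summable.of_nat_of_neg (by simpa using hc) (by simpa using hc)

theorem summable_symbol {c : ℕ → ℝ} (hc : Summable fun τ => |c τ|) (ω : ℝ) :
    Summable fun τ : ℤ => c τ.natAbs * Real.cos (ω * τ) := by
  refine (summable_natAbs hc).of_norm_bounded fun τ => ?_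
  rw [norm_mul, Real.norm_eq_abs, Real.norm_eq_abs]
  exact mul_le_of_le_one_right (abs_nonneg _) (Real.abs_cos_le_one _)

theorem spectralDensity_eq_symbol {Ω : Type*} [MeasurableSpace Ω] {X : ℕ → Ω → ℝ} {μ : Measure Ω}
    (hc : Summable fun τ => |autocov X μ τ|) (ω : ℝ) :
    spectralDensity X μ ω = symbol (autocov X μ) ω := by
  have hs : Summable fun τ : ℤ => (autocov X μ τ.natAbs : ℂ) *
      Complex.exp (-Complex.I * (ω : ℂ) * (τ : ℂ)) := by
    refine (summable_natAbs hc).of_norm_bounded fun τ => ?_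
    rw [show -Complex.I * (ω : ℂ) * (τ : ℂ) = ((-(ω * τ) : ℝ) : ℂ) * Complex.I by
      push_cast; ring, norm_mul, Complex.norm_exp_ofReal_mul_I, Complex.norm_real, mul_one,
      Real.norm_eq_abs]
  rw [spectralDensity, symbol, show (1 / (2 * (π : ℂ))) = ((1 / (2 * π) : ℝ) : ℂ) by push_cast; rfl,
    Complex.re_ofReal_mul, Complex.re_tsum hs]
  congr 2
  ext τ
  rw [Complex.re_ofReal_mul, show -Complex.I * (ω : ℂ) * (τ : ℂ) =
    ((-(ω * τ) : ℝ) : ℂ) * Complex.I by push_cast; ring, Complex.exp_ofReal_mul_I_re, Real.cos_neg]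

theorem continuous_symbol {c : ℕ → ℝ} (hc : Summable fun τ => |c τ|) : Continuous (symbol c) := by
  refine continuous_const.mul (continuous_tsum (fun τ => by fun_prop) (summable_natAbs hc)
    fun τ ω => ?_)
  rw [norm_mul, Real.norm_eq_abs, Real.norm_eq_abs]
  exact mul_le_of_le_one_right (abs_nonneg _) (Real.abs_cos_le_one _)

theorem integral_cos_int (n : ℤ) :
    ∫ ω in (-π)..π, Real.cos (ω * n) = if n = 0 then 2 * π else 0 := by
  split_ifs with hn
  · subst hn; simp; ring
  · have hn' : (n : ℝ) ≠ 0 := by exact_mod_cast hn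
    rw [intervalIntegral.integral_comp_mul_right _ hn', integral_cos]
    simp [mul_comm π, Real.sin_int_mul_pi]

theorem integral_cos_mul_cos_int (n k : ℤ) :
    ∫ ω in (-π)..π, Real.cos (ω * n) * Real.cos (ω * k) =
      (if n = k then π else 0) + (if n = -k then π else 0) := by
  have h : ∀ ω : ℝ, Real.cos (ω * n) * Real.cos (ω * k) =
      1 / 2 * Real.cos (ω * (n - k : ℤ)) + 1 / 2 * Real.cos (ω * (n + k : ℤ)) := by
    intro ω
    push_cast
    rw [mul_sub, mul_add, Real.cos_sub, Real.cos_add]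
    ring
  simp_rw [h]
  rw [intervalIntegral.integral_add (by apply Continuous.intervalIntegrable; fun_prop)
    (by apply Continuous.intervalIntegrable; fun_prop), intervalIntegral.integral_const_mul,
    intervalIntegral.integral_const_mul, integral_cos_int, integral_cos_int]
  simp only [sub_eq_zero, add_eq_zero_iff_eq_neg]
  split_ifs <;> ring

theorem integral_symbol_mul_cos {c : ℕ → ℝ} (hc : Summable fun τ => |c τ|) (k : ℤ) :
    ∫ ω in (-π)..π, symbol c ω * Real.cos (ω * k) = c k.natAbs := by
  have h := intervalIntegral.hasSum_integral_of_dominated_convergence (μ := volume) (a := -π)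
    (b := π) (ι := ℤ)
    (F := fun τ ω => c τ.natAbs * Real.cos (ω * τ) * Real.cos (ω * k))
    (f := fun ω => (∑' τ : ℤ, c τ.natAbs * Real.cos (ω * τ)) * Real.cos (ω * k))
    (bound := fun τ _ => |c τ.natAbs|)
    (fun τ => by apply Continuous.aestronglyMeasurable; fun_prop)
    (fun τ => ae_of_all _ fun ω _ => by
      rw [norm_mul, norm_mul, mul_assoc]
      refine mul_le_of_le_one_right (abs_nonneg _) ?_
      exact mul_le_one₀ (Real.abs_cos_le_one _) (abs_nonneg _) (Real.abs_cos_le_one _))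
    (ae_of_all _ fun ω _ => summable_natAbs hc)
    (by simp)
    (ae_of_all _ fun ω _ => (summable_symbol hc ω).hasSum.mul_right _)
  -- The lags `k` and `-k` contribute `π c(|k|)` each. For `k = 0` both indicators fire at the same
  -- lag, so the total is `2π c(|k|)` in every case.
  have hterm : ∀ τ : ℤ, ∫ ω in (-π)..π, c τ.natAbs * Real.cos (ω * τ) * Real.cos (ω * k) =
      (if τ = k then π * c k.natAbs else 0) + (if τ = -k then π * c k.natAbs else 0) := by
    intro τ
    simp_rw [mul_assoc]
    rw [intervalIntegral.integral_const_mul, integral_cos_mul_cos_int, mul_add]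
    congr 1
    · split_ifs with h1
      · rw [h1]; ring
      · simp
    · split_ifs with h1
      · rw [h1, Int.natAbs_neg]; ring
      · simp
  simp_rw [hterm] at h
  have h2 := (hasSum_ite_eq k (π * c k.natAbs)).add (hasSum_ite_eq (-k) (π * c k.natAbs))
  have h3 := h.unique h2
  simp only [symbol, mul_assoc]
  rw [intervalIntegral.integral_const_mul, h3]
  field_simp
  ring

/-- Fourier inversion. This turns a bound on the spectral densities into a bound on the
autocovariances that is uniform in lag and parameter. -/
theorem abs_le_of_symbol_le {c : ℕ → ℝ} (hc : Summable fun τ => |c τ|) {M : ℝ}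
    (hM : ∀ ω ∈ Icc (-π) π, |symbol c ω| ≤ M) (τ : ℕ) : |c τ| ≤ 2 * π * M := by
  have h := integral_symbol_mul_cos hc τ
  rw [Int.natAbs_natCast] at h
  rw [← h, ← Real.norm_eq_abs]
  have := intervalIntegral.norm_integral_le_of_norm_le_const (a := -π) (b := π) (C := M)
    (f := fun ω => symbol c ω * Real.cos (ω * (τ : ℤ))) (fun ω hω => by
      rw [uIoc_of_le (by linarith [Real.pi_pos])] at hω
      have h1 := hM ω ⟨hω.1.le, hω.2⟩
      rw [norm_mul]
      exact (mul_le_of_le_one_right (norm_nonneg _) (Real.abs_cos_le_one _)).trans h1)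
  refine this.trans (le_of_eq ?_)
  rw [sub_neg_eq_add, abs_of_pos (by positivity)]
  ring

/-- The integral of `symbol c - m` against the nonnegative function `|∑ a_t e^{iωt}|²` is
nonnegative, and inversion evaluates it as the Toeplitz form minus `2π m ∑ a_t²`. -/
theorem le_toeplitzForm {c : ℕ → ℝ} (hc : Summable fun τ => |c τ|) {m : ℝ}
    (hm : ∀ ω ∈ Icc (-π) π, m ≤ symbol c ω) (N : ℕ) (a : ℕ → ℝ) :
    2 * π * m * ∑ t ∈ Finset.range N, a t ^ 2 ≤ toeplitzForm c N a := by
  have hS := continuous_symbol hc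
  have hsum : ∀ ω : ℝ, ∑ b : Bool, (∑ t ∈ Finset.range N, trigVec ω b t * a t) ^ 2 =
      ∑ s ∈ Finset.range N, ∑ t ∈ Finset.range N,
        a s * a t * Real.cos (ω * ((s : ℤ) - t : ℤ)) := by
    intro ω
    simp_rw [sq, Finset.sum_mul_sum]
    rw [Finset.sum_comm]
    refine Finset.sum_congr rfl fun s _ => ?_
    rw [Finset.sum_comm]
    refine Finset.sum_congr rfl fun t _ => ?_
    rw [← sum_trigVec_mul, Finset.mul_sum]
    refine Finset.sum_congr rfl fun b _ => ?_
    ring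
  have hnonneg : 0 ≤ ∫ ω in (-π)..π, (symbol c ω - m) *
      ∑ s ∈ Finset.range N, ∑ t ∈ Finset.range N,
        a s * a t * Real.cos (ω * ((s : ℤ) - t : ℤ)) := by
    refine intervalIntegral.integral_nonneg (by linarith [Real.pi_pos]) fun ω hω => ?_
    rw [← hsum]
    exact mul_nonneg (sub_nonneg.2 (hm ω hω)) (Finset.sum_nonneg fun b _ => sq_nonneg _)
  have hone : ∀ k : ℤ, ∫ ω in (-π)..π, (symbol c ω - m) * Real.cos (ω * k) =
      c k.natAbs - if k = 0 then 2 * π * m else 0 := by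
    intro k
    simp_rw [sub_mul]
    rw [intervalIntegral.integral_sub (by apply Continuous.intervalIntegrable; fun_prop)
      (by apply Continuous.intervalIntegrable; fun_prop), integral_symbol_mul_cos hc,
      intervalIntegral.integral_const_mul, integral_cos_int]
    split_ifs <;> ring
  have hval : ∫ ω in (-π)..π, (symbol c ω - m) *
      ∑ s ∈ Finset.range N, ∑ t ∈ Finset.range N,
        a s * a t * Real.cos (ω * ((s : ℤ) - t : ℤ)) =
      toeplitzForm c N a - 2 * π * m * ∑ t ∈ Finset.range N, a t ^ 2 := by
    have hexp : ∀ ω : ℝ, (symbol c ω - m) * ∑ s ∈ Finset.range N, ∑ t ∈ Finset.range N,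
        a s * a t * Real.cos (ω * ((s : ℤ) - t : ℤ)) =
        ∑ s ∈ Finset.range N, ∑ t ∈ Finset.range N,
          a s * a t * ((symbol c ω - m) * Real.cos (ω * ((s : ℤ) - t : ℤ))) := by
      intro ω
      simp_rw [Finset.mul_sum]
      refine Finset.sum_congr rfl fun s _ => Finset.sum_congr rfl fun t _ => ?_
      ring
    simp_rw [hexp]
    rw [intervalIntegral.integral_finsetSum
      fun s _ => by apply Continuous.intervalIntegrable; fun_prop]
    rw [toeplitzForm, Finset.mul_sum, ← Finset.sum_sub_distrib]
    refine Finset.sum_congr rfl fun s hs => ?_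
    rw [intervalIntegral.integral_finsetSum
      fun t _ => by apply Continuous.intervalIntegrable; fun_prop]
    simp_rw [intervalIntegral.integral_const_mul, hone, mul_sub]
    rw [Finset.sum_sub_distrib]
    congr 1
    have : ∀ t ∈ Finset.range N, (a s * a t * if (s : ℤ) - t = 0 then 2 * π * m else 0) =
        if s = t then 2 * π * m * a s ^ 2 else 0 := by
      intro t _
      by_cases hst : s = t
      · subst hst; simp; ring
      · rw [if_neg hst, if_neg (by omega), mul_zero]
    rw [Finset.sum_congr rfl this, Finset.sum_ite_eq, if_pos hs]
  linarith

theorem symbol_sub {c c' : ℕ → ℝ} (hc : Summable fun τ => |c τ|) (hc' : Summable fun τ => |c' τ|)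
    (ω : ℝ) : symbol (c - c') ω = symbol c ω - symbol c' ω := by
  simp only [symbol, Pi.sub_apply, sub_mul]
  rw [(summable_symbol hc ω).tsum_sub (summable_symbol hc' ω), mul_sub]

theorem symbol_neg (c : ℕ → ℝ) (ω : ℝ) : symbol (-c) ω = -symbol c ω := by
  simp [symbol, tsum_neg]

theorem toeplitzForm_sub (c c' : ℕ → ℝ) (N : ℕ) (a : ℕ → ℝ) :
    toeplitzForm (c - c') N a = toeplitzForm c N a - toeplitzForm c' N a := by
  simp only [toeplitzForm, Pi.sub_apply, mul_sub, Finset.sum_sub_distrib]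

theorem toeplitzForm_neg (c : ℕ → ℝ) (N : ℕ) (a : ℕ → ℝ) :
    toeplitzForm (-c) N a = -toeplitzForm c N a := by
  simp [toeplitzForm]

theorem toeplitzForm_le {c : ℕ → ℝ} (hc : Summable fun τ => |c τ|) {M : ℝ}
    (hM : ∀ ω ∈ Icc (-π) π, symbol c ω ≤ M) (N : ℕ) (a : ℕ → ℝ) :
    toeplitzForm c N a ≤ 2 * π * M * ∑ t ∈ Finset.range N, a t ^ 2 := by
  have h := le_toeplitzForm (c := -c) (by simpa using hc) (m := -M)
    (fun ω hω => by rw [symbol_neg]; exact neg_le_neg (hM ω hω)) N a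
  rw [toeplitzForm_neg] at h
  linarith

/-! ### Bounds on the expected periodogram -/

variable {Ω : Type*} [MeasurableSpace Ω] {μ ν : Measure Ω} {X : ℕ → Ω → ℝ}

/-- `cos² + sin² = 1` removes the frequency, so the bounds below hold uniformly in `ω`. -/
theorem sum_sq_trigVec_mul (g : ℕ → ℝ) (N : ℕ) (ω : ℝ) :
    ∑ b : Bool, ∑ t ∈ Finset.range N, (trigVec ω b t * g t) ^ 2 =
      ∑ t ∈ Finset.range N, g t ^ 2 := by
  rw [Finset.sum_comm]
  refine Finset.sum_congr rfl fun t _ => ?_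
  simp only [mul_pow]
  rw [← Finset.sum_mul]
  simp [trigVec]

theorem le_expectedPeriodogram (h : IsStationaryGaussian X μ)
    (hc : Summable fun τ => |autocov X μ τ|) {m : ℝ}
    (hm : ∀ ω ∈ Icc (-π) π, m ≤ spectralDensity X μ ω) (g : ℕ → ℝ) (N : ℕ) (ω : ℝ) :
    2 * π * m * (1 / N * ∑ t ∈ Finset.range N, g t ^ 2) ≤
      expectedPeriodogram (modulate g X) μ N ω := by
  simp_rw [spectralDensity_eq_symbol hc] at hm
  rw [expectedPeriodogram_eq_toeplitzForm h, mul_left_comm, ← sum_sq_trigVec_mul g N ω,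
    Finset.mul_sum]
  gcongr with b
  exact le_toeplitzForm hc hm N _

theorem expectedPeriodogram_le (h : IsStationaryGaussian X μ)
    (hc : Summable fun τ => |autocov X μ τ|) {M : ℝ}
    (hM : ∀ ω ∈ Icc (-π) π, spectralDensity X μ ω ≤ M) (g : ℕ → ℝ) (N : ℕ) (ω : ℝ) :
    expectedPeriodogram (modulate g X) μ N ω ≤
      2 * π * M * (1 / N * ∑ t ∈ Finset.range N, g t ^ 2) := by
  simp_rw [spectralDensity_eq_symbol hc] at hM
  rw [expectedPeriodogram_eq_toeplitzForm h, mul_left_comm, ← sum_sq_trigVec_mul g N ω,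
    Finset.mul_sum _ _ (2 * π * M)]
  gcongr with b
  exact toeplitzForm_le hc hM N _

/-- The Toeplitz bound is applied to the difference of the autocovariances; the symbol may have any
sign there. The resulting modulus of continuity in the parameter is uniform in `N` and `ω` and needs
only closeness of the spectral densities, not of the autocovariances in `ℓ¹`. -/
theorem expectedPeriodogram_sub_le (hμ : IsStationaryGaussian X μ) (hν : IsStationaryGaussian X ν)
    (hcμ : Summable fun τ => |autocov X μ τ|) (hcν : Summable fun τ => |autocov X ν τ|) {η : ℝ}
    (hη : ∀ ω ∈ Icc (-π) π, spectralDensity X μ ω - spectralDensity X ν ω ≤ η)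
    (g : ℕ → ℝ) (N : ℕ) (ω : ℝ) :
    expectedPeriodogram (modulate g X) μ N ω - expectedPeriodogram (modulate g X) ν N ω ≤
      2 * π * η * (1 / N * ∑ t ∈ Finset.range N, g t ^ 2) := by
  have hsub : Summable fun τ => |(autocov X μ - autocov X ν) τ| :=
    (hcμ.add hcν).of_nonneg_of_le (fun _ => abs_nonneg _) fun τ => abs_sub _ _
  simp_rw [spectralDensity_eq_symbol hcμ, spectralDensity_eq_symbol hcν,
    ← symbol_sub hcμ hcν] at hη
  rw [expectedPeriodogram_eq_toeplitzForm hμ, expectedPeriodogram_eq_toeplitzForm hν, ← mul_sub,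
    ← Finset.sum_sub_distrib, mul_left_comm, ← sum_sq_trigVec_mul g N ω,
    Finset.mul_sum _ _ (2 * π * η)]
  simp_rw [← toeplitzForm_sub]
  gcongr with b
  exact toeplitzForm_le hsub hη N _

end

section

/-! ### Identification -/

/-- A quadratic lower bound on the Whittle divergence. -/
theorem sq_sub_div_le_log {a b M : ℝ} (ha : 0 < a) (hb : 0 < b) (haM : a ≤ M) (hbM : b ≤ M) :
    (a - b) ^ 2 / (4 * M ^ 2) ≤ Real.log b + a / b - Real.log a - 1 := by
  set x := a / b with hx
  have hx0 : 0 < x := div_pos ha hb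
  have hlog : Real.log b - Real.log a = -Real.log x := by
    rw [hx, Real.log_div ha.ne' hb.ne']; ring
  have hs0 : 0 < √x := Real.sqrt_pos.2 hx0
  have hss : √x ^ 2 = x := Real.sq_sqrt hx0.le
  -- Using `log x = 2 log √x` gives `x - 1 - log x ≥ (√x - 1)²`; multiplying by `(√x + 1)² ≤ 2 (x +
  -- 1)` recovers `(x - 1)²`.
  have hlx : Real.log x ≤ 2 * (√x - 1) := by
    have h1 := Real.log_le_sub_one_of_pos hs0
    have h2 : Real.log x = 2 * Real.log √x := by
      rw [← hss, Real.log_pow, Real.sqrt_sq hs0.le]; simp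
    linarith
  have h1 : (x - 1) ^ 2 ≤ (x - 1 - Real.log x) * (2 * (x + 1)) := by
    have h2 : (√x - 1) ^ 2 ≤ x - 1 - Real.log x := by nlinarith
    have h3 : (x - 1) ^ 2 = (√x - 1) ^ 2 * (√x + 1) ^ 2 := by
      rw [← mul_pow]; congr 1; nlinarith
    have h4 : (√x + 1) ^ 2 ≤ 2 * (x + 1) := by nlinarith [sq_nonneg (√x - 1)]
    rw [h3]
    exact mul_le_mul h2 h4 (sq_nonneg _) ((sq_nonneg _).trans h2)
  have h5 : (a - b) ^ 2 ≤ (x - 1 - Real.log x) * (2 * (a + b) * b) := by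
    have ea : a = x * b := by rw [hx]; field_simp
    calc (a - b) ^ 2 = (x - 1) ^ 2 * b ^ 2 := by rw [ea]; ring
      _ ≤ (x - 1 - Real.log x) * (2 * (x + 1)) * b ^ 2 :=
          mul_le_mul_of_nonneg_right h1 (sq_nonneg _)
      _ = _ := by rw [ea]; ring
  have h6 : 0 ≤ x - 1 - Real.log x := by linarith [Real.log_le_sub_one_of_pos hx0]
  have hM : 0 < M := ha.trans_le haM
  rw [div_le_iff₀ (by positivity)]
  calc (a - b) ^ 2 ≤ (x - 1 - Real.log x) * (2 * (a + b) * b) := h5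
    _ ≤ (x - 1 - Real.log x) * (4 * M ^ 2) := by
        refine mul_le_mul_of_nonneg_left ?_ h6
        nlinarith [mul_le_mul haM hbM hb.le hM.le, mul_le_mul hbM hbM hb.le hM.le]
    _ = _ := by rw [show x - 1 - Real.log x = Real.log b + x - Real.log a - 1 by linarith]

/-- The trigonometric polynomial with coefficients `c_g^{(N)}(τ) c(τ)`. -/
noncomputable def trigPoly (g c : ℕ → ℝ) (N : ℕ) (ω : ℝ) : ℝ :=
  1 / N * ∑ s ∈ Finset.range N, ∑ t ∈ Finset.range N,
    g s * g t * c ((s : ℤ) - t).natAbs * Real.cos (ω * ((s : ℤ) - t : ℤ))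

theorem sum_cos_mul_cos_fourierFrequencies {N : ℕ} (hN : 0 < N) (n k : ℤ) :
    ∑ ω ∈ fourierFrequencies N, Real.cos (ω * n) * Real.cos (ω * k) =
      N / 2 * ((if (N : ℤ) ∣ n - k then 1 else 0) + if (N : ℤ) ∣ n + k then 1 else 0) := by
  have h : ∀ ω : ℝ, Real.cos (ω * n) * Real.cos (ω * k) =
      1 / 2 * Real.cos (ω * (n - k : ℤ)) + 1 / 2 * Real.cos (ω * (n + k : ℤ)) := by
    intro ω
    push_cast
    rw [mul_sub, mul_add, Real.cos_sub, Real.cos_add]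
    ring
  simp_rw [h]
  rw [Finset.sum_add_distrib, ← Finset.mul_sum, ← Finset.mul_sum, sum_cos_fourierFrequencies hN,
    sum_cos_fourierFrequencies hN]
  split_ifs <;> ring

/-- The Fourier coefficients of `trigPoly` on the Fourier frequencies are circular correlations. -/
theorem sum_trigPoly_mul_cos (g c : ℕ → ℝ) {N : ℕ} (hN : 0 < N) (τ : ℕ) :
    1 / N * ∑ ω ∈ fourierFrequencies N, trigPoly g c N ω * Real.cos (ω * τ) =
      1 / N * ∑ t ∈ Finset.range N, g ((t + τ) % N) * g t *
        c ((((t + τ) % N : ℕ) : ℤ) - t).natAbs := by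
  have hN' : (N : ℝ) ≠ 0 := by exact_mod_cast hN.ne'
  set f : ℕ → ℕ → ℝ := fun s t => g s * g t * c ((s : ℤ) - t).natAbs with hf
  have hsymm : ∀ s t, f s t = f t s := by
    intro s t
    simp only [hf]
    rw [show ((s : ℤ) - t).natAbs = ((t : ℤ) - s).natAbs by omega]
    ring
  have h1 : ∑ ω ∈ fourierFrequencies N, trigPoly g c N ω * Real.cos (ω * τ) =
      ∑ s ∈ Finset.range N, ∑ t ∈ Finset.range N, f s t * (1 / 2) *
        ((if (N : ℤ) ∣ (s : ℤ) - t - τ then 1 else 0) +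
          if (N : ℤ) ∣ (s : ℤ) - t + τ then 1 else 0) := by
    simp only [trigPoly, Finset.mul_sum, Finset.sum_mul]
    rw [Finset.sum_comm]
    refine Finset.sum_congr rfl fun s _ => ?_
    rw [Finset.sum_comm]
    refine Finset.sum_congr rfl fun t _ => ?_
    have := sum_cos_mul_cos_fourierFrequencies hN ((s : ℤ) - t) τ
    rw [Int.cast_natCast] at this
    calc ∑ ω ∈ fourierFrequencies N, 1 / (N : ℝ) * (g s * g t * c ((s : ℤ) - t).natAbs *
          Real.cos (ω * ((s : ℤ) - t : ℤ))) * Real.cos (ω * τ)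
        = 1 / N * f s t * ∑ ω ∈ fourierFrequencies N,
          Real.cos (ω * ((s : ℤ) - t : ℤ)) * Real.cos (ω * τ) := by
          rw [Finset.mul_sum]
          refine Finset.sum_congr rfl fun ω _ => ?_
          simp only [hf]; ring
      _ = _ := by rw [this]; field_simp
  -- By symmetry of `f` the congruences `s - t ≡ τ` and `s - t ≡ -τ` contribute equally, which
  -- absorbs the factor `1 / 2`.
  have h2 : ∑ s ∈ Finset.range N, ∑ t ∈ Finset.range N, f s t * (1 / 2) *
        ((if (N : ℤ) ∣ (s : ℤ) - t - τ then 1 else 0) +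
          if (N : ℤ) ∣ (s : ℤ) - t + τ then 1 else 0) =
      ∑ t ∈ Finset.range N, ∑ s ∈ Finset.range N,
        f s t * if (N : ℤ) ∣ (s : ℤ) - t - τ then 1 else 0 := by
    simp only [mul_add, Finset.sum_add_distrib]
    have h3 : ∑ s ∈ Finset.range N, ∑ t ∈ Finset.range N,
        (f s t * (1 / 2) * if (N : ℤ) ∣ (s : ℤ) - t + τ then 1 else 0) =
        ∑ t ∈ Finset.range N, ∑ s ∈ Finset.range N,
          f s t * (1 / 2) * if (N : ℤ) ∣ (s : ℤ) - t - τ then 1 else 0 := by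
      refine Finset.sum_congr rfl fun s _ => Finset.sum_congr rfl fun t _ => ?_
      rw [hsymm]
      congr 2
      rw [← Int.dvd_neg, show -((s : ℤ) - t + τ) = (t : ℤ) - s - τ by ring]
    rw [h3, Finset.sum_comm, ← Finset.sum_add_distrib]
    refine Finset.sum_congr rfl fun t _ => ?_
    rw [← Finset.sum_add_distrib]
    refine Finset.sum_congr rfl fun s _ => ?_
    ring
  rw [h1, h2]
  congr 1
  refine Finset.sum_congr rfl fun t ht => ?_
  have h4 : ∀ s ∈ Finset.range N, (f s t * if (N : ℤ) ∣ (s : ℤ) - t - τ then 1 else 0) =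
      if (t + τ) % N = s then f s t else 0 := by
    intro s hs
    have hiff : (N : ℤ) ∣ (s : ℤ) - t - τ ↔ (t + τ) % N = s := by
      rw [Finset.mem_range] at hs
      rw [show (s : ℤ) - t - τ = (s : ℕ) - (t + τ : ℕ) by push_cast; ring, ← Nat.modEq_iff_dvd,
        Nat.ModEq, Nat.mod_eq_of_lt hs]
    simp only [hiff]
    split_ifs <;> simp
  rw [Finset.sum_congr rfl h4, Finset.sum_ite_eq, if_pos (Finset.mem_range.2 (Nat.mod_lt _ hN))]

/-- In the circular correlation the indices `t < N - τ` do not wrap around and give the main term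
exactly. The remaining `τ` terms are each at most `G² B`. -/
theorem abs_sum_trigPoly_mul_cos_sub_le {g c : ℕ → ℝ} {G B : ℝ} (hg : ∀ t, |g t| ≤ G)
    (hc : ∀ t, |c t| ≤ B) {N τ : ℕ} (hN : 0 < N) (hτ : τ ≤ N) :
    |1 / N * ∑ ω ∈ fourierFrequencies N, trigPoly g c N ω * Real.cos (ω * τ) -
      sampleAutocov g N τ * c τ| ≤ τ * (G ^ 2 * B) / N := by
  rw [sum_trigPoly_mul_cos g c hN]
  set f : ℕ → ℝ := fun t => g ((t + τ) % N) * g t * c ((((t + τ) % N : ℕ) : ℤ) - t).natAbs with hf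
  have hsplit : ∑ t ∈ Finset.range N, f t = ∑ t ∈ Finset.range (N - τ), f t +
      ∑ t ∈ Finset.range τ, f (N - τ + t) := by
    rw [← Finset.sum_range_add, Nat.sub_add_cancel hτ]
  have hmain : ∑ t ∈ Finset.range (N - τ), f t =
      (∑ t ∈ Finset.range (N - τ), g t * g (t + τ)) * c τ := by
    rw [Finset.sum_mul]
    refine Finset.sum_congr rfl fun t ht => ?_
    rw [Finset.mem_range] at ht
    simp only [hf]
    rw [Nat.mod_eq_of_lt (by omega), show (((t + τ : ℕ) : ℤ) - t).natAbs = τ by omega]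
    ring
  have hG : 0 ≤ G := (abs_nonneg _).trans (hg 0)
  have hbound : ∀ t, |f t| ≤ G ^ 2 * B := by
    intro t
    simp only [hf]
    rw [abs_mul, abs_mul, sq]
    exact mul_le_mul (mul_le_mul (hg _) (hg _) (abs_nonneg _) hG) (hc _) (abs_nonneg _)
      (mul_nonneg hG hG)
  rw [sampleAutocov, hsplit, hmain]
  have : 1 / (N : ℝ) * ((∑ t ∈ Finset.range (N - τ), g t * g (t + τ)) * c τ +
      ∑ t ∈ Finset.range τ, f (N - τ + t)) -
      1 / N * (∑ t ∈ Finset.range (N - τ), g t * g (t + τ)) * c τ =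
      (∑ t ∈ Finset.range τ, f (N - τ + t)) / N := by ring
  rw [this, abs_div, Nat.abs_cast]
  refine div_le_div_of_nonneg_right ?_ (Nat.cast_nonneg _)
  refine (Finset.abs_sum_le_sum_abs _ _).trans ?_
  refine (Finset.sum_le_sum fun t _ => hbound _).trans ?_
  simp

/-- A Bessel-type bound by Cauchy–Schwarz: a single large Fourier coefficient forces a large
quadratic mean. -/
theorem sq_sum_mul_cos_le {N : ℕ} (hN : 0 < N) (F : ℝ → ℝ) (τ : ℕ) :
    (1 / N * ∑ ω ∈ fourierFrequencies N, F ω * Real.cos (ω * τ)) ^ 2 ≤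
      1 / N * ∑ ω ∈ fourierFrequencies N, F ω ^ 2 := by
  have hN' : (0 : ℝ) < N := by exact_mod_cast hN
  have h := sq_sum_le_card_mul_sum_sq (s := fourierFrequencies N)
    (f := fun ω => F ω * Real.cos (ω * τ))
  rw [card_fourierFrequencies hN] at h
  have h2 : ∑ ω ∈ fourierFrequencies N, (F ω * Real.cos (ω * τ)) ^ 2 ≤
      ∑ ω ∈ fourierFrequencies N, F ω ^ 2 := by
    refine Finset.sum_le_sum fun ω _ => ?_
    rw [mul_pow]
    exact mul_le_of_le_one_right (sq_nonneg _) (Real.cos_sq_le_one _)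
  calc (1 / (N : ℝ) * ∑ ω ∈ fourierFrequencies N, F ω * Real.cos (ω * τ)) ^ 2
      = 1 / (N : ℝ) ^ 2 * (∑ ω ∈ fourierFrequencies N, F ω * Real.cos (ω * τ)) ^ 2 := by
        rw [mul_pow]; congr 1; field_simp
    _ ≤ 1 / (N : ℝ) ^ 2 * (N * ∑ ω ∈ fourierFrequencies N, F ω ^ 2) := by
        gcongr
        exact h.trans (by gcongr)
    _ = _ := by field_simp

/-- If `c_g^{(N)}` stays away from zero at the lags `Γ`, then `trigPoly g c N` stays away from zero
in quadratic mean, uniformly over the bounded `c` that are not small at all lags of `Γ`. -/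
theorem eventually_le_sum_trigPoly_sq {g : ℕ → ℝ} {G B ρ δ : ℝ} (hg : ∀ t, |g t| ≤ G)
    (hρ : 0 < ρ) (hδ : 0 < δ) {Γ : Finset ℕ}
    (hΓ : ∀ τ ∈ Γ, ∀ᶠ N : ℕ in atTop, ρ ≤ |sampleAutocov g N τ|) :
    ∀ᶠ N : ℕ in atTop, ∀ c : ℕ → ℝ, (∀ t, |c t| ≤ B) → (∃ τ ∈ Γ, δ ≤ |c τ|) →
      (ρ * δ / 2) ^ 2 ≤ 1 / N * ∑ ω ∈ fourierFrequencies N, trigPoly g c N ω ^ 2 := by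
  -- The wrap-around error is made to cost at most half of the main term `ρ δ`. It depends on `c`
  -- only through `B`, so the threshold for `N` is uniform in `c`.
  have hsmall : ∀ τ ∈ Γ, ∀ᶠ N : ℕ in atTop, τ * (G ^ 2 * B) / N ≤ ρ * δ / 2 := fun τ _ =>
    (tendsto_const_div_atTop_nhds_zero_nat _).eventually_le_const (by positivity)
  have hle : ∀ τ ∈ Γ, ∀ᶠ N : ℕ in atTop, τ ≤ N := fun τ _ => eventually_ge_atTop τ
  filter_upwards [(Filter.eventually_all_finset Γ).2 hΓ, (Filter.eventually_all_finset Γ).2 hsmall,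
    (Filter.eventually_all_finset Γ).2 hle, eventually_gt_atTop 0] with N h1 h2 h3 hN c hc hcΓ
  obtain ⟨τ, hτ, hcτ⟩ := hcΓ
  refine le_trans ?_ (sq_sum_mul_cos_le hN (trigPoly g c N) τ)
  have h4 := (abs_sum_trigPoly_mul_cos_sub_le hg hc hN (h3 τ hτ)).trans (h2 τ hτ)
  have h5 : ρ * δ ≤ |sampleAutocov g N τ * c τ| := by
    rw [abs_mul]
    exact mul_le_mul (h1 τ hτ) hcτ hδ.le (abs_nonneg _)
  have h6 := abs_sub_abs_le_abs_sub (sampleAutocov g N τ * c τ)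
    (1 / N * ∑ ω ∈ fourierFrequencies N, trigPoly g c N ω * Real.cos (ω * τ))
  rw [abs_sub_comm] at h6
  rw [← sq_abs (1 / (N : ℝ) * _)]
  gcongr
  linarith

/-- Through this bound a correlation of `g` that stays away from zero at one lag keeps the mean
square of `g`, and hence the expected periodogram, away from zero. -/
theorem abs_sampleAutocov_le (g : ℕ → ℝ) (N τ : ℕ) :
    |sampleAutocov g N τ| ≤ 1 / N * ∑ t ∈ Finset.range N, g t ^ 2 := by
  rw [sampleAutocov, abs_mul, abs_of_nonneg (by positivity : (0 : ℝ) ≤ 1 / N)]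
  gcongr
  have h1 : ∑ t ∈ Finset.range (N - τ), g t ^ 2 ≤ ∑ t ∈ Finset.range N, g t ^ 2 :=
    Finset.sum_le_sum_of_subset_of_nonneg (Finset.range_mono (Nat.sub_le _ _))
      fun _ _ _ => sq_nonneg _
  have h2 : ∑ t ∈ Finset.range (N - τ), g (t + τ) ^ 2 ≤ ∑ t ∈ Finset.range N, g t ^ 2 := by
    rw [← Finset.sum_image (s := Finset.range (N - τ)) (g := fun t => t + τ)
      (f := fun t => g t ^ 2) (fun a _ b _ h => by simpa using h)]
    refine Finset.sum_le_sum_of_subset_of_nonneg ?_ fun _ _ _ => sq_nonneg _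
    intro s hs
    simp only [Finset.mem_image, Finset.mem_range] at hs ⊢
    omega
  calc |∑ t ∈ Finset.range (N - τ), g t * g (t + τ)|
      ≤ ∑ t ∈ Finset.range (N - τ), |g t * g (t + τ)| := Finset.abs_sum_le_sum_abs _ _
    _ ≤ ∑ t ∈ Finset.range (N - τ), (1 / 2 * g t ^ 2 + 1 / 2 * g (t + τ) ^ 2) := by
        refine Finset.sum_le_sum fun t _ => ?_
        rw [abs_le]
        constructor <;> nlinarith [sq_nonneg (g t - g (t + τ)), sq_nonneg (g t + g (t + τ))]
    _ ≤ _ := by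
        rw [Finset.sum_add_distrib, ← Finset.mul_sum, ← Finset.mul_sum]
        linarith

theorem mean_sq_le {g : ℕ → ℝ} {G : ℝ} (hg : ∀ t, |g t| ≤ G) (N : ℕ) :
    1 / N * ∑ t ∈ Finset.range N, g t ^ 2 ≤ G ^ 2 := by
  have h : ∑ t ∈ Finset.range N, g t ^ 2 ≤ N * G ^ 2 := by
    refine (Finset.sum_le_sum fun t _ => sq_le_sq' (abs_le.1 (hg t)).1 (abs_le.1 (hg t)).2).trans ?_
    simp
  rcases Nat.eq_zero_or_pos N with rfl | hN
  · simp; positivity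
  · have hN' : (0 : ℝ) < N := by exact_mod_cast hN
    rw [one_div, inv_mul_le_iff₀ hN']
    exact h

variable {Ω : Type*} [MeasurableSpace Ω] {μ ν : Measure Ω} {X : ℕ → Ω → ℝ}

theorem expectedPeriodogram_eq_trigPoly (h : IsStationaryGaussian X μ) (g : ℕ → ℝ) (N : ℕ)
    (ω : ℝ) : expectedPeriodogram (modulate g X) μ N ω = trigPoly g (autocov X μ) N ω := by
  rw [expectedPeriodogram_eq_toeplitzForm h, sum_toeplitzForm_trigVec, trigPoly]

theorem trigPoly_sub (g c c' : ℕ → ℝ) (N : ℕ) (ω : ℝ) :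
    trigPoly g c N ω - trigPoly g c' N ω = trigPoly g (c - c') N ω := by
  simp only [trigPoly, Pi.sub_apply, ← mul_sub, ← Finset.sum_sub_distrib, ← sub_mul]

end

/-! ### Existence of a minimiser -/

section Minimiser

variable {Ω E : Type*} [MeasurableSpace Ω] {X : ℕ → Ω → ℝ}

theorem exists_isSpectralEstimate [TopologicalSpace E] {Θ : Set E} {P : E → Measure Ω}
    (g : ℕ → ℝ) (hΘ : IsCompact Θ) (hne : Θ.Nonempty)
    (hX : ∀ θ ∈ Θ, IsStationaryGaussian X (P θ))
    (hc : ∀ τ : ℕ, ContinuousOn (fun θ => autocov X (P θ) τ) Θ)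
    (hpos : ∀ N, (∃ t < N, g t ≠ 0) → ∀ θ ∈ Θ, ∀ ω,
      0 < expectedPeriodogram (modulate g X) (P θ) N ω)
    (N : ℕ) (y : ℕ → ℝ) :
    ∃ γ, IsSpectralEstimate Θ P (modulate g X) N y γ := by
  have hcont : ∀ ω, ContinuousOn
      (fun θ => expectedPeriodogram (modulate g X) (P θ) N ω) Θ := by
    intro ω
    have h1 : ContinuousOn (fun θ => trigPoly g (autocov X (P θ)) N ω) Θ := by
      unfold trigPoly
      refine continuousOn_const.mul (continuousOn_finsetSum _ fun s _ =>
        continuousOn_finsetSum _ fun t _ => ?_)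
      exact (continuousOn_const.mul (hc _)).mul continuousOn_const
    exact h1.congr fun θ hθ => expectedPeriodogram_eq_trigPoly (hX θ hθ) g N ω
  have hℓ : ContinuousOn (pseudoLikelihood P (modulate g X) N y) Θ := by
    by_cases h : ∃ t < N, g t ≠ 0
    · unfold pseudoLikelihood
      refine continuousOn_const.mul (continuousOn_finsetSum _ fun ω _ => ?_)
      exact ((hcont ω).log fun θ hθ => (hpos N h θ hθ ω).ne').add
        (continuousOn_const.div (hcont ω) fun θ hθ => (hpos N h θ hθ ω).ne')
    -- Here `g` vanishes on the whole sample (in particular if `N = 0`). The conventions `log 0 = 0`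
    -- and `x / 0 = 0` make the likelihood identically zero on `Θ`.
    · push Not at h
      have h0 : ∀ θ ∈ Θ, ∀ ω, expectedPeriodogram (modulate g X) (P θ) N ω = 0 := by
        intro θ hθ ω
        rw [expectedPeriodogram_eq_trigPoly (hX θ hθ), trigPoly]
        refine mul_eq_zero_of_right _ (Finset.sum_eq_zero fun s hs =>
          Finset.sum_eq_zero fun t _ => ?_)
        rw [h s (Finset.mem_range.1 hs)]
        ring
      refine (continuousOn_const (c := (0 : ℝ))).congr fun θ hθ => ?_
      simp [pseudoLikelihood, h0 θ hθ]
  obtain ⟨γ, hγ, hmin⟩ := hΘ.exists_isMinOn hne hℓ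
  exact ⟨γ, hγ, hmin⟩

end Minimiser

/-! ### Consistency -/

section Consistency

variable {Ω E : Type*} [MeasurableSpace Ω] {X : ℕ → Ω → ℝ} {P : E → Measure Ω}

/-- A parameter whose likelihood beats that of `θ` is either close to `θ`, in the sense of expected
periodograms, or the periodogram deviates from its expectation. -/
theorem sum_sq_sub_le_of_pseudoLikelihood_le {g : ℕ → ℝ} {N : ℕ} {γ θ : E} {w : Ω} {M : ℝ}
    (hγ : ∀ ω, 0 < expectedPeriodogram (modulate g X) (P γ) N ω)
    (hθ : ∀ ω, 0 < expectedPeriodogram (modulate g X) (P θ) N ω)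
    (hγM : ∀ ω, expectedPeriodogram (modulate g X) (P γ) N ω ≤ M)
    (hθM : ∀ ω, expectedPeriodogram (modulate g X) (P θ) N ω ≤ M)
    (hle : pseudoLikelihood P (modulate g X) N (fun t => modulate g X t w) γ ≤
      pseudoLikelihood P (modulate g X) N (fun t => modulate g X t w) θ) :
    (1 / N * ∑ ω ∈ fourierFrequencies N, (expectedPeriodogram (modulate g X) (P γ) N ω -
        expectedPeriodogram (modulate g X) (P θ) N ω) ^ 2) / (4 * M ^ 2) ≤
      centredMean g X (P θ) N (fun ω => 1 / expectedPeriodogram (modulate g X) (P θ) N ω) w -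
      centredMean g X (P θ) N (fun ω => 1 / expectedPeriodogram (modulate g X) (P γ) N ω) w := by
  set a := expectedPeriodogram (modulate g X) (P θ) N
  set b := expectedPeriodogram (modulate g X) (P γ) N
  set s := periodogram (fun t => modulate g X t w) N with hs
  -- Adding the centred terms replaces the observed `s` by its mean `a` in the difference of the
  -- summands: the right-hand side equals `log b + a / b - log a - 1`.
  have hterm : ∀ ω, (b ω - a ω) ^ 2 / (4 * M ^ 2) ≤
      (Real.log (b ω) + s ω / b ω) - (Real.log (a ω) + s ω / a ω) +
        (1 / a ω * (s ω - a ω) - 1 / b ω * (s ω - a ω)) := by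
    intro ω
    have h := sq_sub_div_le_log (hθ ω) (hγ ω) (hθM ω) (hγM ω)
    rw [show (b ω - a ω) ^ 2 = (a ω - b ω) ^ 2 by ring]
    refine h.trans (le_of_eq ?_)
    have ha := (hθ ω).ne'
    have hb := (hγ ω).ne'
    change Real.log (b ω) + a ω / b ω - Real.log (a ω) - 1 = _
    field_simp
    ring
  have hsum := Finset.sum_le_sum fun ω (_ : ω ∈ fourierFrequencies N) => hterm ω
  rw [← Finset.sum_div, Finset.sum_add_distrib, Finset.sum_sub_distrib,
    Finset.sum_sub_distrib] at hsum
  have hmul := mul_le_mul_of_nonneg_left hsum (by positivity : (0 : ℝ) ≤ 1 / N)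
  have hle' : 1 / (N : ℝ) * ∑ ω ∈ fourierFrequencies N, (Real.log (b ω) + s ω / b ω) ≤
      1 / N * ∑ ω ∈ fourierFrequencies N, (Real.log (a ω) + s ω / a ω) := hle
  simp only [centredMean]
  rw [mul_div_assoc]
  linarith

/-- Since `s, a ≥ 0`, one has `|s - a| ≤ s + a ≤ (s - a) + 2 M`. Changing the weights thus costs at
most `η` times a quantity free of the weights, which is what allows passing to a finite net. -/
theorem abs_centredMean_sub_le {μ : Measure Ω} {g : ℕ → ℝ} {N : ℕ} (hN : 0 < N) {φ ψ : ℝ → ℝ}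
    {η M : ℝ} {w : Ω} (hφψ : ∀ ω, |φ ω - ψ ω| ≤ η)
    (h0 : ∀ ω, 0 ≤ expectedPeriodogram (modulate g X) μ N ω)
    (hM : ∀ ω, expectedPeriodogram (modulate g X) μ N ω ≤ M) :
    |centredMean g X μ N φ w - centredMean g X μ N ψ w| ≤
      η * (centredMean g X μ N (fun _ => 1) w + 2 * M) := by
  have hN' : (0 : ℝ) < N := by exact_mod_cast hN
  have hη : 0 ≤ η := (abs_nonneg _).trans (hφψ 0)
  set a := expectedPeriodogram (modulate g X) μ N
  set s := periodogram (fun t => modulate g X t w) N with hs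
  have hs0 : ∀ ω, 0 ≤ s ω := fun ω => periodogram_nonneg _ _ _
  have hterm : ∀ ω, |φ ω * (s ω - a ω) - ψ ω * (s ω - a ω)| ≤ η * (1 * (s ω - a ω) + 2 * M) := by
    intro ω
    rw [← sub_mul, abs_mul]
    refine mul_le_mul (hφψ ω) ?_ (abs_nonneg _) hη
    rw [abs_le]
    have h1 : a ω ≤ M := hM ω
    have h2 : 0 ≤ a ω := h0 ω
    constructor <;> linarith [hs0 ω]
  have hsum : |∑ ω ∈ fourierFrequencies N, (φ ω * (s ω - a ω) - ψ ω * (s ω - a ω))| ≤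
      ∑ ω ∈ fourierFrequencies N, η * (1 * (s ω - a ω) + 2 * M) :=
    (Finset.abs_sum_le_sum_abs _ _).trans (Finset.sum_le_sum fun ω _ => hterm ω)
  simp only [centredMean]
  rw [← mul_sub, ← Finset.sum_sub_distrib, abs_mul, abs_of_pos (by positivity : (0 : ℝ) < 1 / N)]
  refine (mul_le_mul_of_nonneg_left hsum (by positivity)).trans (le_of_eq ?_)
  rw [← Finset.mul_sum, Finset.sum_add_distrib, Finset.sum_const, card_fourierFrequencies hN,
    nsmul_eq_mul]
  change _ = η * (1 / N * ∑ ω ∈ fourierFrequencies N, 1 * (s ω - a ω) + 2 * M)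
  field_simp

theorem abs_one_div_sub_one_div_le {a b L η : ℝ} (hL : 0 < L) (ha : L ≤ a) (hb : L ≤ b)
    (hab : |a - b| ≤ η) : |1 / a - 1 / b| ≤ η / L ^ 2 := by
  have ha0 := hL.trans_le ha
  have hb0 := hL.trans_le hb
  have hη : 0 ≤ η := (abs_nonneg _).trans hab
  rw [show 1 / a - 1 / b = (b - a) / (a * b) by field_simp, abs_div, abs_sub_comm,
    abs_of_pos (mul_pos ha0 hb0), sq]
  gcongr

/-- The sum of the gaps over `Γ` is continuous and, by injectivity, positive on the compact set of
parameters at distance at least `ε`. At some lag the gap is at least the average, hence the division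
of the minimum by the cardinality. -/
theorem exists_le_abs_sub_of_injOn [PseudoMetricSpace E] {Θ : Set E} (hΘ : IsCompact Θ)
    {c : E → ℕ → ℝ} {Γ : Finset ℕ} {θ₀ : E} (hθ₀ : θ₀ ∈ Θ)
    (hc : ∀ τ, ContinuousOn (fun θ => c θ τ) Θ)
    (hinj : InjOn (fun θ => fun τ : Γ => c θ (τ : ℕ)) Θ) {ε : ℝ} (hε : 0 < ε) :
    ∃ δ > 0, ∀ γ ∈ Θ, ε ≤ dist γ θ₀ → ∃ τ ∈ Γ, δ ≤ |c γ τ - c θ₀ τ| := by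
  set K := Θ ∩ {γ | ε ≤ dist γ θ₀} with hK
  have hKc : IsCompact K :=
    hΘ.inter_right (isClosed_le continuous_const (continuous_id.dist continuous_const))
  rcases K.eq_empty_or_nonempty with hE | hne
  · exact ⟨1, one_pos, fun γ hγ hd => absurd (show γ ∈ K from ⟨hγ, hd⟩) (by simp [hE])⟩
  have hcont : ContinuousOn (fun γ => ∑ τ ∈ Γ, |c γ τ - c θ₀ τ|) K :=
    continuousOn_finsetSum _ fun τ _ =>
      (((hc τ).mono inter_subset_left).sub continuousOn_const).abs
  obtain ⟨γ₁, hγ₁, hmin⟩ := hKc.exists_isMinOn hne hcont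
  have hex : ∃ τ ∈ Γ, c γ₁ τ ≠ c θ₀ τ := by
    by_contra! hcon
    have : γ₁ = θ₀ := hinj hγ₁.1 hθ₀ (funext fun τ => hcon τ τ.2)
    have h2 : ε ≤ dist γ₁ θ₀ := hγ₁.2
    rw [this, dist_self] at h2
    linarith
  obtain ⟨τ₁, hτ₁, hne₁⟩ := hex
  set D := ∑ τ ∈ Γ, |c γ₁ τ - c θ₀ τ| with hD
  have hDpos : 0 < D :=
    (abs_pos.2 (sub_ne_zero.2 hne₁)).trans_le
      (Finset.single_le_sum (f := fun τ => |c γ₁ τ - c θ₀ τ|) (fun _ _ => abs_nonneg _) hτ₁)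
  have hcard : (0 : ℝ) < Γ.card := by exact_mod_cast Finset.card_pos.2 ⟨τ₁, hτ₁⟩
  refine ⟨D / Γ.card, by positivity, fun γ hγ hd => ?_⟩
  have hle : D ≤ ∑ τ ∈ Γ, |c γ τ - c θ₀ τ| := hmin (show γ ∈ K from ⟨hγ, hd⟩)
  refine Finset.exists_le_of_sum_le ⟨τ₁, hτ₁⟩ ?_
  rw [Finset.sum_const, nsmul_eq_mul]
  refine le_trans (le_of_eq ?_) hle
  field_simp

theorem tendsto_measure_dist_of_isSpectralEstimate [PseudoMetricSpace E] {Θ : Set E} {g : ℕ → ℝ}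
    {θ₀ : E} (hΘ : IsCompact Θ) (hθ₀ : θ₀ ∈ Θ)
    (hX : ∀ θ ∈ Θ, IsStationaryGaussian X (P θ))
    (hsum : ∀ θ ∈ Θ, Summable (fun τ : ℕ => |autocov X (P θ) τ|))
    (hc : ∀ τ : ℕ, ContinuousOn (fun θ => autocov X (P θ) τ) Θ)
    (hS : ContinuousOn (fun p : ℝ × E => spectralDensity X (P p.2) p.1) (Icc (-π) π ×ˢ Θ))
    {m M : ℝ} (hm : 0 < m) (hSm : ∀ θ ∈ Θ, ∀ ω ∈ Icc (-π) π, m ≤ spectralDensity X (P θ) ω)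
    (hSM : ∀ θ ∈ Θ, ∀ ω ∈ Icc (-π) π, spectralDensity X (P θ) ω ≤ M)
    {G : ℝ} (hG : 0 < G) (hg : ∀ t, |g t| ≤ G)
    {Γ : Finset ℕ} (hne : Γ.Nonempty)
    (hinj : InjOn (fun θ => fun τ : Γ => autocov X (P θ) (τ : ℕ)) Θ)
    (hΓ : ∀ τ ∈ Γ, 0 < liminf (fun N : ℕ => |sampleAutocov g N τ|) atTop)
    {θhat : ℕ → Ω → E}
    (hθhat : ∀ N w, IsSpectralEstimate Θ P (modulate g X) N (fun t => modulate g X t w) (θhat N w))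
    {ε : ℝ} (hε : 0 < ε) :
    Tendsto (fun N => P θ₀ {w | ε ≤ dist (θhat N w) θ₀}) atTop (𝓝 0) := by
  -- Half of the smallest liminf over the finite set `Γ` serves as a common eventual lower bound.
  obtain ⟨ρ, hρ, hρΓ⟩ : ∃ ρ > 0, ∀ τ ∈ Γ, ∀ᶠ N : ℕ in atTop, ρ ≤ |sampleAutocov g N τ| := by
    obtain ⟨τ₁, hτ₁, hmin⟩ := Γ.exists_min_image
      (fun τ => liminf (fun N : ℕ => |sampleAutocov g N τ|) atTop) hne
    refine ⟨_, half_pos (hΓ τ₁ hτ₁), fun τ hτ => ?_⟩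
    refine (eventually_lt_of_lt_liminf ((half_lt_self (hΓ τ₁ hτ₁)).trans_le (hmin τ hτ))
      ?_).mono fun _ h => h.le
    exact isBoundedUnder_of ⟨0, fun _ => abs_nonneg _⟩
  have hA : ∀ᶠ N : ℕ in atTop, ρ ≤ 1 / (N : ℝ) * ∑ t ∈ Finset.range N, g t ^ 2 := by
    obtain ⟨τ, hτ⟩ := hne
    filter_upwards [hρΓ τ hτ] with N hN using hN.trans (abs_sampleAutocov_le g N τ)
  have hmM : m ≤ M := (hSm θ₀ hθ₀ 0 (by simp [Real.pi_pos.le])).trans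
    (hSM θ₀ hθ₀ 0 (by simp [Real.pi_pos.le]))
  have hM : 0 < M := hm.trans_le hmM
  set L := 2 * π * m * ρ with hLdef
  set B := 2 * π * M * G ^ 2 with hBdef
  have hL : 0 < L := by positivity
  have hB : 0 < B := by positivity
  have hlow : ∀ᶠ N : ℕ in atTop, ∀ θ ∈ Θ, ∀ ω,
      L ≤ expectedPeriodogram (modulate g X) (P θ) N ω := by
    filter_upwards [hA] with N hN θ hθ ω
    refine le_trans ?_ (le_expectedPeriodogram (hX θ hθ) (hsum θ hθ) (hSm θ hθ) g N ω)
    rw [hLdef]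
    gcongr
  have hup : ∀ N, ∀ θ ∈ Θ, ∀ ω, expectedPeriodogram (modulate g X) (P θ) N ω ≤ B := by
    intro N θ hθ ω
    refine (expectedPeriodogram_le (hX θ hθ) (hsum θ hθ) (hSM θ hθ) g N ω).trans ?_
    rw [hBdef]
    gcongr
    exact mean_sq_le hg N
  have hcb : ∀ θ ∈ Θ, ∀ τ, |autocov X (P θ) τ| ≤ 2 * π * M := by
    intro θ hθ τ
    refine abs_le_of_symbol_le (hsum θ hθ) (fun ω hω => ?_) τ
    rw [← spectralDensity_eq_symbol (hsum θ hθ), abs_of_nonneg (hm.le.trans (hSm θ hθ ω hω))]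
    exact hSM θ hθ ω hω
  obtain ⟨δ, hδ, hδΓ⟩ := exists_le_abs_sub_of_injOn hΘ hθ₀ hc hinj hε
  set κ := (ρ * δ / 2) ^ 2 / (4 * B ^ 2) with hκdef
  have hκ : 0 < κ := by positivity
  have hident : ∀ᶠ N : ℕ in atTop, ∀ γ ∈ Θ, ε ≤ dist γ θ₀ →
      (ρ * δ / 2) ^ 2 ≤ 1 / N * ∑ ω ∈ fourierFrequencies N,
        (expectedPeriodogram (modulate g X) (P γ) N ω -
          expectedPeriodogram (modulate g X) (P θ₀) N ω) ^ 2 := by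
    filter_upwards [eventually_le_sum_trigPoly_sq (B := 2 * π * M + 2 * π * M) hg hρ hδ hρΓ]
      with N hN γ hγ hd
    have h := hN (autocov X (P γ) - autocov X (P θ₀))
      (fun τ => (abs_sub _ _).trans (add_le_add (hcb γ hγ τ) (hcb θ₀ hθ₀ τ))) (hδΓ γ hγ hd)
    simpa only [expectedPeriodogram_eq_trigPoly (hX γ hγ),
      expectedPeriodogram_eq_trigPoly (hX θ₀ hθ₀), trigPoly_sub] using h
  -- The tolerance `η` is chosen so that replacing a parameter by its net point costs at most `κ /
  -- 4`, on the event that the centred mean with unit weights is below `1`.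
  obtain ⟨η, hη, hηκ⟩ : ∃ η > 0, 2 * π * η * G ^ 2 / L ^ 2 * (1 + 2 * B) = κ / 4 := by
    refine ⟨κ / 4 * L ^ 2 / (2 * π * G ^ 2 * (1 + 2 * B)), by positivity, ?_⟩
    field_simp
  obtain ⟨r, hr, hrS⟩ : ∃ r > 0, ∀ γ ∈ Θ, ∀ γ' ∈ Θ, dist γ γ' < r → ∀ ω ∈ Icc (-π) π,
      |spectralDensity X (P γ) ω - spectralDensity X (P γ') ω| ≤ η := by
    have huc := (isCompact_Icc.prod hΘ).uniformContinuousOn_of_continuous hS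
    obtain ⟨r, hr, h⟩ := Metric.uniformContinuousOn_iff.1 huc η hη
    refine ⟨r, hr, fun γ hγ γ' hγ' hd ω hω => ?_⟩
    have := h (ω, γ) ⟨hω, hγ⟩ (ω, γ') ⟨hω, hγ'⟩ (by simpa [Prod.dist_eq] using hd)
    rw [Real.dist_eq] at this
    exact this.le
  -- The radius `r` does not depend on `N`, so one finite net serves all sample sizes.
  obtain ⟨F, hFΘ, hFfin, hFcov⟩ := hΘ.finite_cover_balls hr
  set φ : E → ℕ → ℝ → ℝ := fun γ N ω => 1 / expectedPeriodogram (modulate g X) (P γ) N ω with hφ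
  have hnet : ∀ᶠ N : ℕ in atTop, ∀ γ ∈ Θ, ∃ γ' ∈ F, ∀ ω,
      |φ γ N ω - φ γ' N ω| ≤ 2 * π * η * G ^ 2 / L ^ 2 := by
    filter_upwards [hlow] with N hN γ hγ
    obtain ⟨γ', hγ', hball⟩ := mem_iUnion₂.1 (hFcov hγ)
    have hγ'Θ := hFΘ hγ'
    refine ⟨γ', hγ', fun ω => abs_one_div_sub_one_div_le hL (hN γ hγ ω) (hN γ' hγ'Θ ω) ?_⟩
    have hd := hrS γ hγ γ' hγ'Θ hball
    have hmean : 2 * π * η * (1 / N * ∑ t ∈ Finset.range N, g t ^ 2) ≤ 2 * π * η * G ^ 2 := by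
      gcongr
      exact mean_sq_le hg N
    have h1 := expectedPeriodogram_sub_le (hX γ hγ) (hX γ' hγ'Θ) (hsum γ hγ) (hsum γ' hγ'Θ)
      (fun ω hω => (abs_le.1 (hd ω hω)).2) g N ω
    have h2 := expectedPeriodogram_sub_le (η := η) (hX γ' hγ'Θ) (hX γ hγ) (hsum γ' hγ'Θ)
      (hsum γ hγ)
      (fun ω hω => by linarith [(abs_le.1 (hd ω hω)).1]) g N ω
    rw [abs_le]
    constructor <;> linarith
  have hφL : ∀ γ ∈ Θ, ∀ᶠ N : ℕ in atTop, ∀ ω ∈ fourierFrequencies N, |φ γ N ω| ≤ 1 / L := by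
    intro γ hγ
    filter_upwards [hlow] with N hN ω _
    have := hN γ hγ ω
    rw [hφ, abs_of_nonneg (by have := hL.trans_le this; positivity)]
    exact one_div_le_one_div_of_le hL this
  classical
  set F' := insert θ₀ hFfin.toFinset with hF'
  have hF'Θ : ∀ γ ∈ F', γ ∈ Θ := by
    intro γ hγ
    rcases Finset.mem_insert.1 hγ with rfl | h
    · exact hθ₀
    · exact hFΘ (hFfin.mem_toFinset.1 h)
  have hlim : Tendsto (fun N => (∑ γ ∈ F', P θ₀ {w | κ / 4 ≤
      |centredMean g X (P θ₀) N (φ γ N) w|}) +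
      P θ₀ {w | 1 ≤ |centredMean g X (P θ₀) N (fun _ => 1) w|}) atTop (𝓝 0) := by
    have h1 : Tendsto (fun N => ∑ γ ∈ F', P θ₀ {w | κ / 4 ≤
        |centredMean g X (P θ₀) N (φ γ N) w|}) atTop (𝓝 (∑ γ ∈ F', 0)) :=
      tendsto_finsetSum _ fun γ hγ => tendsto_measure_centredMean (hX θ₀ hθ₀) (hsum θ₀ hθ₀) hg
        (hφL γ (hF'Θ γ hγ)) (by positivity)
    have h2 := tendsto_measure_centredMean (hX θ₀ hθ₀) (hsum θ₀ hθ₀) hg (φ := fun _ _ => 1)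
      (K := 1) (Eventually.of_forall fun _ _ _ => by simp) one_pos
    simpa using h1.add h2
  refine tendsto_of_tendsto_of_tendsto_of_le_of_le' tendsto_const_nhds hlim
    (Eventually.of_forall fun _ => zero_le) ?_
  filter_upwards [hlow, hident, hnet, eventually_gt_atTop 0] with N hlowN hidentN hnetN hN
  -- Off the exceptional events, a far minimiser would give `κ ≤ 3κ/4`: one quarter each from the
  -- truth, the net point and the passage to the net point. Only monotonicity and subadditivity of
  -- the measure are applied to this inclusion, so `θhat` may be chosen arbitrarily, even
  -- non-measurably.
  have hsub : {w | ε ≤ dist (θhat N w) θ₀} ⊆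
      (⋃ γ ∈ F', {w | κ / 4 ≤ |centredMean g X (P θ₀) N (φ γ N) w|}) ∪
        {w | 1 ≤ |centredMean g X (P θ₀) N (fun _ => 1) w|} := by
    intro w hw
    by_contra hcon
    simp only [mem_union, mem_iUnion, mem_ofPred_eq, not_or, not_exists, not_le] at hcon
    obtain ⟨hcon1, hcon2⟩ := hcon
    obtain ⟨hγΘ, hmin⟩ := hθhat N w
    set γ := θhat N w
    have h1 := sum_sq_sub_le_of_pseudoLikelihood_le (w := w)
      (fun ω => hL.trans_le (hlowN γ hγΘ ω)) (fun ω => hL.trans_le (hlowN θ₀ hθ₀ ω))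
      (hup N γ hγΘ) (hup N θ₀ hθ₀) (hmin hθ₀)
    have h2 : κ ≤ centredMean g X (P θ₀) N (φ θ₀ N) w - centredMean g X (P θ₀) N (φ γ N) w :=
      (div_le_div_of_nonneg_right (hidentN γ hγΘ hw) (by positivity)).trans h1
    obtain ⟨γ', hγ', hclose⟩ := hnetN γ hγΘ
    have h3 := abs_centredMean_sub_le (w := w) hN hclose
      (fun ω => hL.le.trans (hlowN θ₀ hθ₀ ω)) (hup N θ₀ hθ₀)
    have h4 : 2 * π * η * G ^ 2 / L ^ 2 *
        (centredMean g X (P θ₀) N (fun _ => 1) w + 2 * B) ≤ κ / 4 := by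
      rw [← hηκ]
      gcongr
      exact (le_abs_self _).trans hcon2.le
    have h5 := abs_lt.1 (hcon1 θ₀ (Finset.mem_insert_self _ _))
    have h6 := abs_lt.1 (hcon1 γ' (Finset.mem_insert_of_mem (hFfin.mem_toFinset.2 hγ')))
    have h7 := abs_le.1 (h3.trans h4)
    linarith [h5.2, h6.1, h7.1]
  exact (measure_mono hsub).trans ((measure_union_le _ _).trans
    (add_le_add_left (measure_biUnion_finset_le _ _) _))

end Consistency

end ModulatedSeries

theorem theorem1 {d : ℕ} {Ω : Type*} [MeasurableSpace Ω]
    (Θ : Set (EuclideanSpace ℝ (Fin d)))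
    (P : EuclideanSpace ℝ (Fin d) → Measure Ω)
    (X : ℕ → Ω → ℝ) (g : ℕ → ℝ) (θ₀ : EuclideanSpace ℝ (Fin d))
    (hΘ : IsCompact Θ) (hθ₀ : θ₀ ∈ interior Θ)
    (hX : ∀ θ ∈ Θ, ModulatedSeries.IsStationaryGaussian X (P θ))
    (hsum : ∀ θ ∈ Θ, Summable (fun τ : ℕ => |ModulatedSeries.autocov X (P θ) τ|))
    (hc : ∀ τ : ℕ, ContinuousOn (fun θ => ModulatedSeries.autocov X (P θ) τ) Θ)
    (hS : ContinuousOn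
      (fun p : ℝ × EuclideanSpace ℝ (Fin d) => ModulatedSeries.spectralDensity X (P p.2) p.1)
      (Icc (-π) π ×ˢ Θ))
    (hSpos : ∀ θ ∈ Θ, ∀ ω ∈ Icc (-π) π, 0 < ModulatedSeries.spectralDensity X (P θ) ω)
    (hSdiff : ∀ θ ∈ Θ,
      ContDiffOn ℝ 1 (ModulatedSeries.spectralDensity X (P θ)) (Icc (-π) π))
    (hg : ∃ gmax : ℝ, 0 < gmax ∧ ∀ t, |g t| ≤ gmax)
    (hsig : ModulatedSeries.SignificantCorrelationContribution Θ P X g) :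
    (∀ (N : ℕ) (w : Ω), ∃ γ, ModulatedSeries.IsSpectralEstimate Θ P
      (ModulatedSeries.modulate g X) N (fun t => ModulatedSeries.modulate g X t w) γ) ∧
    ∀ θhat : ℕ → Ω → EuclideanSpace ℝ (Fin d),
      (∀ (N : ℕ) (w : Ω), ModulatedSeries.IsSpectralEstimate Θ P
        (ModulatedSeries.modulate g X) N (fun t => ModulatedSeries.modulate g X t w)
        (θhat N w)) →
      TendstoInMeasure (P θ₀) θhat atTop (fun _ => θ₀) := by
  have hmem : θ₀ ∈ Θ := interior_subset hθ₀
  have hK : IsCompact (Icc (-π) π ×ˢ Θ) := isCompact_Icc.prod hΘ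
  have hKne : (Icc (-π) π ×ˢ Θ).Nonempty := ⟨(0, θ₀), by simp [Real.pi_pos.le], hmem⟩
  obtain ⟨p, hp, hpmin⟩ := hK.exists_isMinOn hKne hS
  obtain ⟨q, hq, hqmax⟩ := hK.exists_isMaxOn hKne hS
  have hm := hSpos p.2 hp.2 p.1 hp.1
  have hSm : ∀ θ ∈ Θ, ∀ ω ∈ Icc (-π) π, ModulatedSeries.spectralDensity X (P p.2) p.1 ≤
      ModulatedSeries.spectralDensity X (P θ) ω := fun θ hθ ω hω =>
    hpmin (show (ω, θ) ∈ Icc (-π) π ×ˢ Θ from ⟨hω, hθ⟩)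
  have hSM : ∀ θ ∈ Θ, ∀ ω ∈ Icc (-π) π, ModulatedSeries.spectralDensity X (P θ) ω ≤
      ModulatedSeries.spectralDensity X (P q.2) q.1 := fun θ hθ ω hω =>
    hqmax (show (ω, θ) ∈ Icc (-π) π ×ˢ Θ from ⟨hω, hθ⟩)
  refine ⟨fun N w => ?_, fun θhat hθhat => ?_⟩
  · refine ModulatedSeries.exists_isSpectralEstimate g hΘ ⟨θ₀, hmem⟩ hX hc ?_ N _
    rintro N ⟨t, htN, hgt⟩ θ hθ ω
    refine lt_of_lt_of_le ?_ (ModulatedSeries.le_expectedPeriodogram (hX θ hθ) (hsum θ hθ)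
      (hSm θ hθ) g N ω)
    have hN : (0 : ℝ) < N := by exact_mod_cast (Nat.zero_le t).trans_lt htN
    have hgpos : 0 < ∑ t ∈ Finset.range N, g t ^ 2 :=
      Finset.sum_pos' (fun _ _ => sq_nonneg _) ⟨t, Finset.mem_range.2 htN, by positivity⟩
    positivity
  · obtain ⟨Γ, hinj, hΓ⟩ := hsig
    obtain ⟨G, hG, hgG⟩ := hg
    rw [tendstoInMeasure_iff_dist]
    intro ε hε
    -- With no lags, injectivity forces `Θ` to be the single point `θ₀`. This case is separate
    -- because nothing then bounds `g` away from zero.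
    rcases Γ.eq_empty_or_nonempty with rfl | hne
    · have heq : ∀ N w, θhat N w = θ₀ := fun N w =>
        hinj (hθhat N w).1 hmem (funext fun τ => absurd τ.2 (Finset.notMem_empty _))
      simp [heq, hε.not_ge]
    · exact ModulatedSeries.tendsto_measure_dist_of_isSpectralEstimate hΘ hmem hX hsum hc hS hm
        hSm hSM hG hgG hne hinj hΓ hθhat hε
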